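/- **Theorem.** Let $\mathfrak S_n$ be the set of permutations of $[n]=\{1,\dots,n\}$. For $\tau\in\mathfrak S_n$ and $\pi\in\mathfrak S_r$, let $X_\pi(\tau)$ be the number of subsets $I=\{i_1<\dots<i_r\}$ of $[n]$ such that, for all $j,k\in[r]$, $\pi(j)>\pi(k)$ if and only if $\tau(i_j)>\tau(i_k)$. A cycle type of size $n$ is a sequence $t=(t_1,\dots,t_n)$ of nonnegative integers with $\sum_{p=1}^n p\,t_p=n$; a uniform $t$-cyclic permutation is a uniformly random element of the set of permutations of $[n]$ having exactly $t_p$ cycles of length $p$ for each $p$ (fixed points being the cycles of length $1$). Let $d_K$ denote the Kolmogorov distance between probability distributions on $\mathbb R$, i.e. the supremum distance between their distribution functions, and let $Y\sim\mathcal N(0,1)$. For each $n$, let $t^{(n)}$ be a cycle type of size $n$ and let $\tau_n$ be a uniform $t^{(n)}$-cyclic permutation. Fix an integer $r\ge 1$ and $\pi\in\mathfrak S_r$. Then for every $n$ such that $\mathrm{Var}(X_\pi(\tau_n))>0$, $$ d_K\!\left(\frac{X_\pi(\tau_n)-\mathbb E[X_\pi(\tau_n)]}{\sqrt{\mathrm{Var}(X_\pi(\tau_n))}},\,Y\right)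 \le 42\,\frac{r}{(r-1)!^2}\,\frac{n^{2r-3/2}}{\mathrm{Var}(X_\pi(\tau_n))} +72\,\frac{r}{(r-1)!^3}\,\frac{n^{3r-2}}{\mathrm{Var}(X_\pi(\tau_n))^{3/2}} . $$ Furthermore, if $\mathrm{Var}(X_\pi(\tau_n))=\sigma^2n^{2r-1}+o(n^{2r-1})$ as $n\to\infty$ for some $\sigma\ge 0$, then $$ \frac{X_\pi(\tau_n)-\mathbb E[X_\pi(\tau_n)]}{n^{r-1/2}}\longrightarrow\mathcal N(0,\sigma^2) $$ in distribution as $n\to\infty$ (where $\mathcal N(0,0)$ is the Dirac mass at $0$), and if moreover $\sigma>0$ then $$ d_K\!\left(\frac{X_\pi(\tau_n)-\mathbb E[X_\pi(\tau_n)]}{\sqrt{\mathrm{Var}(X_\pi(\tau_n))}},\,Y\right)=O(n^{-1/2}) . $$ -/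

import Mathlib

open MeasureTheory ProbabilityTheory Filter Asymptotics

noncomputable section

/-- The discrete σ-algebra on the finite set of permutations of `[n]`. -/
instance permMeasurableSpace (n : ℕ) : MeasurableSpace (Equiv.Perm (Fin n)) := ⊤

instance permDiscreteMeasurableSpace (n : ℕ) :
    DiscreteMeasurableSpace (Equiv.Perm (Fin n)) := ⟨fun _ => trivial⟩

/-- A cycle type of size `n` is a partition `t` of `n`; the number `t_p` of `p`-cycles
(fixed points included, for `p = 1`) is the multiplicity of `p` in `t.parts`.
A permutation of `[n]` is `t`-cyclic if for every `p` it has exactly `t_p` cycles of length `p`. -/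
def IsCyclicOfType {n : ℕ} (t : n.Partition) (τ : Equiv.Perm (Fin n)) : Prop :=
  τ.partition.parts = t.parts

/-- `τ` is a uniformly random `t`-cyclic permutation under `P`. -/
def IsUniformCyclic {n : ℕ} (t : n.Partition) {Ω : Type*} [MeasurableSpace Ω]
    (τ : Ω → Equiv.Perm (Fin n)) (P : Measure Ω) : Prop :=
  HasLaw τ (uniformOn {ρ : Equiv.Perm (Fin n) | IsCyclicOfType t ρ}) P

/-- `pat(I, τ) = π`: the set `I = {i_0 < ⋯ < i_{r-1}}` has size `r`, and
`π j > π k` iff `τ (i_j) > τ (i_k)` for all `j, k`. -/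
def InducesPattern {n r : ℕ} (I : Finset (Fin n)) (τ : Equiv.Perm (Fin n))
    (π : Equiv.Perm (Fin r)) : Prop :=
  ∃ h : I.card = r, ∀ j k : Fin r,
    π j > π k ↔ τ (I.orderEmbOfFin h j) > τ (I.orderEmbOfFin h k)

open Classical in
/-- The pattern count `X_π(τ)`: the number of `r`-element subsets `I` of `[n]` on which `τ`
induces the pattern `π`. -/
def patternCount {n r : ℕ} (π : Equiv.Perm (Fin r)) (τ : Equiv.Perm (Fin n)) : ℕ :=
  ∑ I ∈ (Finset.univ : Finset (Fin n)).powersetCard r, if InducesPattern I τ π then 1 else 0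

/-- The Kolmogorov distance `sup_x |μ((-∞, x]) - ν((-∞, x])|` of two probability measures
on the real line. -/
def kolmogorovDist (μ ν : Measure ℝ) : ℝ :=
  ⨆ x : ℝ, |μ.real (Set.Iic x) - ν.real (Set.Iic x)|

end

/-! A uniform permutation of given cycle type is a fixed `ρ` of that type conjugated by a uniform
permutation, and the conjugator can be taken to be the ranking of independent uniform variables `U
i`. The pattern count then has the law of the number of `r`-sets `I` whose points `(U i, U (ρ i))`
form `π` (`integral_pointCount_eq`). This is a sum of indicators, each depending on at most `2r`
coordinates, with each coordinate entering at most `2 n^(r-1)/(r-1)!` of them, whatever `ρ` is.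

Such sums are treated by Stein's method. Replacing coordinates by independent copies one at a time,
and exchanging the two copies, writes a covariance as `½ ∑ E[D_j Δ_j]`, where `D_j` is `seqDiff` and
`Δ_j` is `coordDiff` (`covariance_eq_sum_diff`). Applied to the standardised sum `W` and the Stein
solution `f` at `W`, this leaves two errors: `E|½ ∑ D_j Δ_j - 1|` with both differences those of
`W`, and a first-order Taylor remainder of `f`. Although `f'` jumps, the remainder is at most an
increment of `W` times the increment of a bounded monotone function of `W`
(`abs_steinSol_sub_sub_le`). Exchanging copies once more turns it into `E|∑ |D_j| Δ_j|`
(`abs_integral_stein_sub_le`).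

The two random sums have means `1` (after halving) and `0`, so both errors are fluctuations, bounded
through `efron_stein`. The outcome has order `n^(2r-3/2)/V`: the first term of the stated bound
already suffices. For `σ > 0` this is `O(n^(-1/2))` and gives the limit law; for `σ = 0` an `L¹`
estimate is enough. -/

section NormalApproximation

open Set Real
open scoped Topology

/-! ### Gaussian tails, the Mills ratio and the Stein solution -/

/-- The unnormalised lower tail `∫_{-∞}^w exp (-t²/2) dt` of the Gaussian. -/
noncomputable def gaussTail (w : ℝ) : ℝ := ∫ t in Iic w, exp (-t ^ 2 / 2)

lemma integrable_exp_neg_sq_half : Integrable fun t : ℝ => exp (-t ^ 2 / 2) := by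
  have h := integrable_exp_neg_mul_sq (b := 1 / 2) (by norm_num)
  refine h.congr (ae_of_all _ fun t => ?_)
  simp only; congr 1; ring

lemma integrable_mul_exp_neg_sq_half : Integrable fun t : ℝ => t * exp (-t ^ 2 / 2) := by
  have h := integrable_mul_exp_neg_mul_sq (b := 1 / 2) (by norm_num)
  refine h.congr (ae_of_all _ fun t => ?_)
  simp only; congr 2; ring

lemma integrable_sq_mul_exp_neg_sq_half : Integrable fun t : ℝ => t ^ 2 * exp (-t ^ 2 / 2) := by
  have h := integrable_rpow_mul_exp_neg_mul_sq (b := 1 / 2) (by norm_num) (s := 2) (by norm_num)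
  refine h.congr (ae_of_all _ fun t => ?_)
  simp only [rpow_ofNat]; congr 2; ring

lemma hasDerivAt_exp_neg_sq_half (t : ℝ) :
    HasDerivAt (fun t : ℝ => exp (-t ^ 2 / 2)) (-t * exp (-t ^ 2 / 2)) t := by
  have h : HasDerivAt (fun t : ℝ => -t ^ 2 / 2) (-t) t := by
    exact (((hasDerivAt_pow 2 t).neg).div_const 2).congr_deriv (by push_cast; ring)
  exact h.exp.congr_deriv (by ring)

lemma tendsto_of_integrable_deriv_atBot {f f' : ℝ → ℝ} (hf : ∀ x, HasDerivAt f (f' x) x)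
    (h' : Integrable f') (h : Integrable f) : Tendsto f atBot (𝓝 0) :=
  tendsto_zero_of_hasDerivAt_of_integrableOn_Iic (a := 0) (fun x _ => hf x) h'.integrableOn
    h.integrableOn

lemma setIntegral_Iic_mul_exp (w : ℝ) :
    ∫ t in Iic w, t * exp (-t ^ 2 / 2) = -exp (-w ^ 2 / 2) := by
  have hd : ∀ x, HasDerivAt (fun t : ℝ => -exp (-t ^ 2 / 2)) (x * exp (-x ^ 2 / 2)) x := fun x =>
    (hasDerivAt_exp_neg_sq_half x).neg.congr_deriv (by ring)
  have := integral_Iic_of_hasDerivAt_of_tendsto' (a := w) (fun x _ => hd x)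
    integrable_mul_exp_neg_sq_half.integrableOn
    (tendsto_of_integrable_deriv_atBot hd integrable_mul_exp_neg_sq_half
      integrable_exp_neg_sq_half.neg)
  rw [this]; ring

lemma setIntegral_Iic_sq_mul_exp (w : ℝ) :
    ∫ t in Iic w, t ^ 2 * exp (-t ^ 2 / 2) = gaussTail w - w * exp (-w ^ 2 / 2) := by
  have hd : ∀ x, HasDerivAt (fun t : ℝ => t * exp (-t ^ 2 / 2))
      (exp (-x ^ 2 / 2) - x ^ 2 * exp (-x ^ 2 / 2)) x := fun x =>
    ((hasDerivAt_id' x).mul (hasDerivAt_exp_neg_sq_half x)).congr_deriv (by ring)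
  have hi := integrable_exp_neg_sq_half.sub integrable_sq_mul_exp_neg_sq_half
  have := integral_Iic_of_hasDerivAt_of_tendsto' (a := w) (fun x _ => hd x) hi.integrableOn
    (tendsto_of_integrable_deriv_atBot hd hi integrable_mul_exp_neg_sq_half)
  rw [integral_sub integrable_exp_neg_sq_half.integrableOn
    integrable_sq_mul_exp_neg_sq_half.integrableOn] at this
  rw [gaussTail]; linarith

lemma hasDerivAt_gaussTail (w : ℝ) : HasDerivAt gaussTail (exp (-w ^ 2 / 2)) w := by
  have hc : Continuous fun t : ℝ => exp (-t ^ 2 / 2) := by fun_prop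
  have h : gaussTail = fun w => gaussTail 0 + ∫ t in (0 : ℝ)..w, exp (-t ^ 2 / 2) := by
    funext w
    rw [gaussTail, gaussTail, ← intervalIntegral.integral_Iic_sub_Iic
      integrable_exp_neg_sq_half.integrableOn integrable_exp_neg_sq_half.integrableOn]
    ring
  rw [h]
  exact (intervalIntegral.integral_hasDerivAt_right (hc.intervalIntegrable _ _)
    (hc.stronglyMeasurableAtFilter _ _) hc.continuousAt).const_add _

/-- The expression is the integral of `(w - t) exp (-t²/2)` over `t ≤ w`. -/
lemma mul_gaussTail_add_exp_nonneg (w : ℝ) : 0 ≤ w * gaussTail w + exp (-w ^ 2 / 2) := by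
  have h : ∫ t in Iic w, (w * exp (-t ^ 2 / 2) - t * exp (-t ^ 2 / 2)) =
      w * gaussTail w + exp (-w ^ 2 / 2) := by
    rw [integral_sub (integrable_exp_neg_sq_half.const_mul w).integrableOn
      integrable_mul_exp_neg_sq_half.integrableOn, setIntegral_Iic_mul_exp, integral_const_mul,
      gaussTail]
    ring
  rw [← h]
  refine setIntegral_nonneg measurableSet_Iic fun t ht => ?_
  rw [← sub_mul]
  exact mul_nonneg (sub_nonneg.2 ht) (exp_pos _).le

/-- The expression is the integral of `(w - t)² exp (-t²/2)` over `t ≤ w`. Up to the factor `exp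
(w²/2)` it is the derivative of `w * millsRatio w`, whence the monotonicity below. -/
lemma sq_mul_gaussTail_add_nonneg (w : ℝ) :
    0 ≤ (1 + w ^ 2) * gaussTail w + w * exp (-w ^ 2 / 2) := by
  have h : ∫ t in Iic w, (w ^ 2 * exp (-t ^ 2 / 2) - 2 * w * (t * exp (-t ^ 2 / 2))
      + t ^ 2 * exp (-t ^ 2 / 2)) = (1 + w ^ 2) * gaussTail w + w * exp (-w ^ 2 / 2) := by
    have hi : Integrable fun t : ℝ => w ^ 2 * exp (-t ^ 2 / 2) - 2 * w * (t * exp (-t ^ 2 / 2)) :=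
      (integrable_exp_neg_sq_half.const_mul _).sub (integrable_mul_exp_neg_sq_half.const_mul _)
    rw [integral_add hi.integrableOn integrable_sq_mul_exp_neg_sq_half.integrableOn,
      integral_sub (integrable_exp_neg_sq_half.const_mul _).integrableOn
      (integrable_mul_exp_neg_sq_half.const_mul _).integrableOn, integral_const_mul,
      integral_const_mul, setIntegral_Iic_mul_exp, setIntegral_Iic_sq_mul_exp, ← gaussTail]
    ring
  rw [← h]
  refine setIntegral_nonneg measurableSet_Iic fun t _ => ?_
  have : w ^ 2 * exp (-t ^ 2 / 2) - 2 * w * (t * exp (-t ^ 2 / 2)) + t ^ 2 * exp (-t ^ 2 / 2)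
    = (w - t) ^ 2 * exp (-t ^ 2 / 2) := by ring
  rw [this]; positivity

lemma gaussTail_add_neg (w : ℝ) : gaussTail w + gaussTail (-w) = √(2 * π) := by
  have h1 : gaussTail (-w) = ∫ t in Ioi w, exp (-t ^ 2 / 2) := by
    rw [gaussTail, ← integral_comp_neg_Ioi]; simp
  rw [h1, gaussTail, ← compl_Iic, integral_add_compl measurableSet_Iic integrable_exp_neg_sq_half]
  have := integral_gaussian (1 / 2)
  rw [show 2 * π = π / (1 / 2) by ring, ← this]
  congr 1; funext t; congr 1; ring

lemma gaussianReal_real_Iic (z : ℝ) :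
    (gaussianReal 0 1).real (Iic z) = gaussTail z / √(2 * π) := by
  rw [measureReal_def, gaussianReal_apply_eq_integral _ one_ne_zero,
    ENNReal.toReal_ofReal (setIntegral_nonneg measurableSet_Iic
      fun _ _ => gaussianPDFReal_nonneg _ _ _), gaussTail, div_eq_inv_mul, ← integral_const_mul]
  congr 1; funext t; simp [gaussianPDFReal]

/-- The ratio of the Gaussian lower tail to the density. -/
noncomputable def millsRatio (w : ℝ) : ℝ := exp (w ^ 2 / 2) * gaussTail w

lemma exp_mul_exp_neg_sq_half (w : ℝ) : exp (w ^ 2 / 2) * exp (-w ^ 2 / 2) = 1 := by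
  rw [← exp_add]; simp [neg_div]

lemma hasDerivAt_millsRatio (w : ℝ) : HasDerivAt millsRatio (w * millsRatio w + 1) w := by
  have h : HasDerivAt (fun t : ℝ => t ^ 2 / 2) w w := by
    exact ((hasDerivAt_pow 2 w).div_const 2).congr_deriv (by norm_num)
  refine (h.exp.mul (hasDerivAt_gaussTail w)).congr_deriv ?_
  rw [exp_mul_exp_neg_sq_half, millsRatio]; ring

lemma neg_one_le_mul_millsRatio (w : ℝ) : -1 ≤ w * millsRatio w := by
  have h := mul_nonneg (exp_pos (w ^ 2 / 2)).le (mul_gaussTail_add_exp_nonneg w)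
  have := exp_mul_exp_neg_sq_half w
  rw [millsRatio]; linear_combination h + this

lemma monotone_mul_millsRatio : Monotone fun w => w * millsRatio w := by
  have hd : ∀ w, HasDerivAt (fun w => w * millsRatio w)
      (1 * millsRatio w + w * (w * millsRatio w + 1)) w := fun w =>
    (hasDerivAt_id w).mul (hasDerivAt_millsRatio w)
  refine monotone_of_deriv_nonneg (fun w => (hd w).differentiableAt) fun w => ?_
  rw [(hd w).deriv]
  have h := mul_nonneg (exp_pos (w ^ 2 / 2)).le (sq_mul_gaussTail_add_nonneg w)
  have := exp_mul_exp_neg_sq_half w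
  rw [millsRatio]; linear_combination h + w * this

/-- The bounded solution of Stein's equation for the half-line `(-∞, z]`. -/
noncomputable def steinSol (z w : ℝ) : ℝ :=
  if w ≤ z then (1 - (gaussianReal 0 1).real (Iic z)) * millsRatio w
  else (gaussianReal 0 1).real (Iic z) * millsRatio (-w)

lemma one_sub_gaussianReal_Iic (z : ℝ) :
    1 - (gaussianReal 0 1).real (Iic z) = gaussTail (-z) / √(2 * π) := by
  have h : √(2 * π) ≠ 0 := by positivity
  rw [gaussianReal_real_Iic, eq_div_iff h, sub_mul, div_mul_cancel₀ _ h, ← gaussTail_add_neg z]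
  ring

/-- By symmetry of the Gaussian, both sides are `exp (z²/2)` times the product of the two tails at
`z`, normalised; hence the branches of `steinSol` glue continuously. -/
lemma millsRatio_match (z : ℝ) :
    (1 - (gaussianReal 0 1).real (Iic z)) * millsRatio z =
      (gaussianReal 0 1).real (Iic z) * millsRatio (-z) := by
  rw [one_sub_gaussianReal_Iic, gaussianReal_real_Iic, millsRatio, millsRatio, neg_sq]; ring

lemma steinSol_of_le {z w : ℝ} (h : w ≤ z) :
    steinSol z w = (1 - (gaussianReal 0 1).real (Iic z)) * millsRatio w := if_pos h

lemma steinSol_of_ge {z w : ℝ} (h : z ≤ w) :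
    steinSol z w = (gaussianReal 0 1).real (Iic z) * millsRatio (-w) := by
  rcases h.eq_or_lt with rfl | h
  · rw [steinSol_of_le le_rfl, millsRatio_match]
  · exact if_neg h.not_ge

/-- On each side of `z` the function is, up to a nonnegative factor, `u * millsRatio u` at `u = w`,
or its negative at `u = -w`. -/
lemma monotone_mul_steinSol (z : ℝ) : Monotone fun w => w * steinSol z w := by
  have hp : 0 ≤ (gaussianReal 0 1).real (Iic z) := measureReal_nonneg
  have hq : 0 ≤ 1 - (gaussianReal 0 1).real (Iic z) := sub_nonneg.2 measureReal_le_one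
  refine MonotoneOn.Iic_union_Ici (a := z) (fun a ha b hb hab => ?_) fun a ha b hb hab => ?_
  · have := mul_le_mul_of_nonneg_left (monotone_mul_millsRatio hab) hq
    simp only [steinSol_of_le (mem_Iic.1 ha), steinSol_of_le (mem_Iic.1 hb)] at this ⊢
    linarith
  · have := mul_le_mul_of_nonneg_left (monotone_mul_millsRatio (neg_le_neg hab)) hp
    simp only [steinSol_of_ge (mem_Ici.1 ha), steinSol_of_ge (mem_Ici.1 hb)] at this ⊢
    linarith

lemma le_mul_steinSol (z w : ℝ) :
    (gaussianReal 0 1).real (Iic z) - 1 ≤ w * steinSol z w := by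
  have hq : 0 ≤ 1 - (gaussianReal 0 1).real (Iic z) := sub_nonneg.2 measureReal_le_one
  refine le_trans ?_ (monotone_mul_steinSol z (min_le_left w z))
  have := mul_le_mul_of_nonneg_left (neg_one_le_mul_millsRatio (min w z)) hq
  simp only [steinSol_of_le (min_le_right w z)]
  linarith

lemma mul_steinSol_le (z w : ℝ) :
    w * steinSol z w ≤ (gaussianReal 0 1).real (Iic z) := by
  have hp : 0 ≤ (gaussianReal 0 1).real (Iic z) := measureReal_nonneg
  refine (monotone_mul_steinSol z (le_max_left w z)).trans ?_
  have := mul_le_mul_of_nonneg_left (neg_one_le_mul_millsRatio (-max w z)) hp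
  simp only [steinSol_of_ge (le_max_right w z)]
  linarith

lemma continuous_steinSol (z : ℝ) : Continuous (steinSol z) := by
  have hM : Continuous millsRatio :=
    continuous_iff_continuousAt.2 fun w => (hasDerivAt_millsRatio w).continuousAt
  refine Continuous.if_le (by fun_prop) (by fun_prop) continuous_id continuous_const ?_
  rintro x rfl; exact millsRatio_match _

/-- Stein's equation for the right derivative. At `w = z` the right branch counts, so the indicator
is strict; one-sided derivatives suffice for the mean value inequality across the kink. -/
lemma hasDerivWithinAt_steinSol (z w : ℝ) :
    HasDerivWithinAt (steinSol z) (w * steinSol z w + (if w < z then 1 else 0)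
      - (gaussianReal 0 1).real (Iic z)) (Ici w) w := by
  rcases lt_or_ge w z with h | h
  · have := ((hasDerivAt_millsRatio w).const_mul (1 - (gaussianReal 0 1).real (Iic z)))
    rw [if_pos h, steinSol_of_le h.le]
    refine HasDerivAt.hasDerivWithinAt ?_
    refine (this.congr_of_eventuallyEq ?_).congr_deriv (by ring)
    filter_upwards [Iio_mem_nhds h] with x hx using steinSol_of_le (le_of_lt hx)
  · have := ((hasDerivAt_millsRatio (-w)).comp w (hasDerivAt_neg w)).const_mul
      ((gaussianReal 0 1).real (Iic z))
    rw [if_neg h.not_gt, steinSol_of_ge h]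
    exact (this.hasDerivWithinAt.congr (fun x hx => steinSol_of_ge (h.trans hx))
      (steinSol_of_ge h)).congr_deriv (by ring)

/-- The monotone function controlling the increments of the derivative of `steinSol z`. -/
noncomputable def steinMono (z w : ℝ) : ℝ := w * steinSol z w - if w ≤ z then 1 else 0

/-- The values lie in an interval of length `2`; centring it brings the sup norm down to `1`. -/
lemma steinMono_sub_mem (z w : ℝ) :
    |steinMono z w - ((gaussianReal 0 1).real (Iic z) - 1)| ≤ 1 := by
  have h1 := le_mul_steinSol z w
  have h2 := mul_steinSol_le z w
  rw [abs_le, steinMono]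
  split_ifs with h
  · constructor <;> linarith
  · constructor <;> linarith

/-- The derivative is a nondecreasing function plus a nonincreasing indicator, so its variation
between `a` and `b` is at most the increment of `steinMono`, their difference up to a constant. The
bound keeps the form of a product of two increments, which can later be symmetrised. -/
lemma abs_steinSol_sub_sub_le (z a b : ℝ) :
    |steinSol z a - steinSol z b - (a - b) * (a * steinSol z a + (if a ≤ z then 1 else 0)
      - (gaussianReal 0 1).real (Iic z))| ≤ (a - b) * (steinMono z a - steinMono z b) := by
  set p := (gaussianReal 0 1).real (Iic z)
  set D := a * steinSol z a + (if a ≤ z then 1 else 0) - p with hD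
  -- Letting the base point `a` be either endpoint treats both orders of `a` and `b` at once.
  have key : ∀ l u : ℝ, l ≤ u → (a = l ∨ a = u) →
      |(steinSol z u - u * D) - (steinSol z l - l * D)| ≤
        (steinMono z u - steinMono z l) * (u - l) := by
    intro l u hlu ha
    have hm := monotone_mul_steinSol z
    have := norm_image_sub_le_of_norm_deriv_right_le_segment
      (f := fun x => steinSol z x - x * D) (a := l) (b := u)
      (f' := fun x => x * steinSol z x + (if x < z then 1 else 0) - p - 1 * D)
      (C := steinMono z u - steinMono z l)
      ((continuous_steinSol z).sub (continuous_id.mul continuous_const)).continuousOn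
      (fun x _ => (hasDerivWithinAt_steinSol z x).sub
        ((hasDerivWithinAt_id x _).mul_const D)) ?_ u (right_mem_Icc.2 hlu)
    · simpa [Real.norm_eq_abs] using this
    · intro x hx
      have h1 := hm hx.1
      have h2 := hm hx.2.le
      have hx1 := hx.1
      have hx2 := hx.2
      simp only [Real.norm_eq_abs, hD, steinMono] at h1 h2 ⊢
      rw [abs_le]
      rcases ha with rfl | rfl <;> split_ifs <;> constructor <;> linarith
  rcases le_total a b with h | h
  · have := key a b h (Or.inl rfl)
    rw [abs_sub_comm] at this
    convert this using 1
    · congr 1; ring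
    · ring
  · have := key b a h (Or.inr rfl)
    convert this using 1
    · congr 1; ring
    · ring

/-! ### Bounded measurable functions -/

/-- Bounded measurable real functions. -/
def BddMeas {E : Type*} [MeasurableSpace E] (f : E → ℝ) : Prop :=
  Measurable f ∧ ∃ C, ∀ x, |f x| ≤ C

namespace BddMeas

variable {E F : Type*} [MeasurableSpace E] [MeasurableSpace F] {f g : E → ℝ}

lemma integrable (hf : BddMeas f) (μ : Measure E) [IsFiniteMeasure μ] : Integrable f μ :=
  let ⟨C, hC⟩ := hf.2
  Integrable.of_bound hf.1.aestronglyMeasurable C (ae_of_all _ hC)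

lemma const (c : ℝ) : BddMeas fun _ : E => c := ⟨measurable_const, |c|, fun _ => le_rfl⟩

lemma add (hf : BddMeas f) (hg : BddMeas g) : BddMeas fun x => f x + g x :=
  let ⟨C, hC⟩ := hf.2
  let ⟨C', hC'⟩ := hg.2
  ⟨hf.1.add hg.1, C + C', fun x => (abs_add_le _ _).trans (add_le_add (hC x) (hC' x))⟩

lemma mul (hf : BddMeas f) (hg : BddMeas g) : BddMeas fun x => f x * g x :=
  let ⟨C, hC⟩ := hf.2
  let ⟨C', hC'⟩ := hg.2
  ⟨hf.1.mul hg.1, C * C', fun x => by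
    rw [abs_mul]
    exact mul_le_mul (hC x) (hC' x) (abs_nonneg _) ((abs_nonneg _).trans (hC x))⟩

lemma sub (hf : BddMeas f) (hg : BddMeas g) : BddMeas fun x => f x - g x := by
  simpa [sub_eq_add_neg] using hf.add ((const (-1)).mul hg)

lemma abs (hf : BddMeas f) : BddMeas fun x => |f x| :=
  let ⟨C, hC⟩ := hf.2
  ⟨hf.1.abs, C, fun x => by rw [abs_abs]; exact hC x⟩

lemma comp (hf : BddMeas f) {u : F → E} (hu : Measurable u) : BddMeas fun x => f (u x) :=
  let ⟨C, hC⟩ := hf.2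
  ⟨hf.1.comp hu, C, fun _ => hC _⟩

lemma sum {ι : Type*} {f : ι → E → ℝ} (s : Finset ι) (hf : ∀ i ∈ s, BddMeas (f i)) :
    BddMeas fun x => ∑ i ∈ s, f i x := by
  classical
  induction s using Finset.induction_on with
  | empty => simpa using const 0
  | insert a s ha ih =>
    simp only [Finset.sum_insert ha]
    exact (hf a (by simp)).add (ih fun i hi => hf i (by simp [hi]))

end BddMeas

/-! ### Interpolation between two independent copies -/

section Mix

variable {A : Type*} {n : ℕ}

/-- The vector with second coordinates on `s` and first coordinates elsewhere. -/
def mix (s : Finset (Fin n)) (z : Fin n → A × A) : Fin n → A :=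
  fun i => if i ∈ s then (z i).2 else (z i).1

/-- Exchange the two entries at coordinate `j`. -/
def swapAt (j : Fin n) (z : Fin n → A × A) : Fin n → A × A :=
  fun i => if i = j then (z i).swap else z i

lemma mix_insert (s : Finset (Fin n)) (j : Fin n) (z : Fin n → A × A) :
    mix (insert j s) z = Function.update (mix s z) j (z j).2 := by
  funext i
  by_cases h : i = j
  · subst h; simp [mix]
  · simp [mix, h]

lemma mix_swapAt {s : Finset (Fin n)} {j : Fin n} (h : j ∉ s) (z : Fin n → A × A) :
    mix s (swapAt j z) = mix (insert j s) z := by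
  funext i
  by_cases hi : i = j
  · subst hi; simp [mix, swapAt, h]
  · simp [mix, swapAt, hi]

lemma mix_insert_swapAt {s : Finset (Fin n)} {j : Fin n} (h : j ∉ s) (z : Fin n → A × A) :
    mix (insert j s) (swapAt j z) = mix s z := by
  funext i
  by_cases hi : i = j
  · subst hi; simp [mix, swapAt, h]
  · simp [mix, swapAt, hi]

lemma mix_singleton (j : Fin n) (z : Fin n → A × A) :
    mix {j} z = Function.update (mix ∅ z) j (z j).2 := mix_insert ∅ j z

lemma mix_update_of_eq (s : Finset (Fin n)) (z : Fin n → A × A) (i : Fin n) (a : A × A)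
    {k : Fin n} (h : k ≠ i) : mix s (Function.update z i a) k = mix s z k := by
  simp [mix, h]

/-- Increment of `g` when the first `j` coordinates are replaced and coordinate `j` is then
replaced too. -/
def seqDiff (g : (Fin n → A) → ℝ) (j : Fin n) (z : Fin n → A × A) : ℝ :=
  g (mix (Finset.Iio j) z) - g (mix (insert j (Finset.Iio j)) z)

/-- Increment of `g` when coordinate `j` is replaced. -/
def coordDiff (g : (Fin n → A) → ℝ) (j : Fin n) (z : Fin n → A × A) : ℝ :=
  g (mix ∅ z) - g (mix {j} z)

/-- The two vectors compared differ only at `j`, and the swap interchanges them. -/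
lemma seqDiff_swapAt (g : (Fin n → A) → ℝ) (j : Fin n) (z : Fin n → A × A) :
    seqDiff g j (swapAt j z) = -seqDiff g j z := by
  rw [seqDiff, mix_swapAt (by simp), mix_insert_swapAt (by simp), seqDiff]; ring

lemma mix_empty_swapAt (j : Fin n) (z : Fin n → A × A) : mix ∅ (swapAt j z) = mix {j} z :=
  mix_swapAt (by simp) z

lemma coordDiff_swapAt (g : (Fin n → A) → ℝ) (j : Fin n) (z : Fin n → A × A) :
    coordDiff g j (swapAt j z) = -coordDiff g j z := by
  have : mix {j} (swapAt j z) = mix ∅ z := mix_insert_swapAt (Finset.notMem_empty j) z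
  rw [coordDiff, mix_empty_swapAt, this, coordDiff]; ring

lemma sum_seqDiff (g : (Fin n → A) → ℝ) (z : Fin n → A × A) :
    ∑ j, seqDiff g j z = g (mix ∅ z) - g (mix Finset.univ z) := by
  set G : ℕ → ℝ := fun k => g (mix (Finset.univ.filter fun i : Fin n => i.val < k) z) with hG
  have h : ∀ j : Fin n, seqDiff g j z = G j.val - G (j.val + 1) := fun j => by
    rw [seqDiff, hG]
    congr 4
    · ext i; simp
    · ext i; simp [le_iff_eq_or_lt, Fin.ext_iff]
  rw [Finset.sum_congr rfl fun j _ => h j, Fin.sum_univ_eq_sum_range (fun k => G k - G (k + 1)),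
    Finset.sum_range_sub', hG]
  simp

end Mix

/-! ### Exchangeable pairs, covariances and Efron–Stein -/

section Independent

variable {A : Type*} [MeasurableSpace A] {n : ℕ} (μ : Measure A) [IsProbabilityMeasure μ]

lemma measurable_mix (s : Finset (Fin n)) : Measurable (mix (A := A) s) := by
  refine measurable_pi_lambda _ fun i => ?_
  by_cases h : i ∈ s <;> simp only [mix, h, if_true, if_false] <;> fun_prop

/-- The law of `n` independent pairs of independent variables with law `μ`. -/
noncomputable abbrev pairLaw (n : ℕ) : Measure (Fin n → A × A) :=
  Measure.pi fun _ => μ.prod μ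

lemma measurePreserving_mix (s : Finset (Fin n)) :
    MeasurePreserving (mix s) (pairLaw μ n) (Measure.pi fun _ => μ) := by
  have := measurePreserving_pi (fun _ : Fin n => μ.prod μ) (fun _ : Fin n => μ)
    (f := fun i => if i ∈ s then Prod.snd else Prod.fst) fun i => by
      split_ifs
      · exact measurePreserving_snd
      · exact measurePreserving_fst
  convert this using 1
  funext z i
  simp only [mix]; split_ifs <;> rfl

lemma measurePreserving_swapAt (j : Fin n) :
    MeasurePreserving (swapAt j) (pairLaw μ n) (pairLaw μ n) := by
  have := measurePreserving_pi (fun _ : Fin n => μ.prod μ) (fun _ : Fin n => μ.prod μ)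
    (f := fun i => if i = j then Prod.swap else id) fun i => by
      split_ifs
      · exact Measure.measurePreserving_swap
      · exact MeasurePreserving.id _
  convert this using 1
  funext z i
  simp only [swapAt]; split_ifs <;> rfl

lemma integral_comp_mix {f : (Fin n → A) → ℝ} (hf : BddMeas f) (s : Finset (Fin n)) :
    ∫ z, f (mix s z) ∂(pairLaw μ n) = ∫ x, f x ∂(Measure.pi fun _ => μ) := by
  rw [← (measurePreserving_mix μ s).map_eq, integral_map (measurable_mix s).aemeasurable
    hf.1.aestronglyMeasurable]

lemma integral_comp_swapAt {f : (Fin n → A × A) → ℝ} (hf : BddMeas f) (j : Fin n) :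
    ∫ z, f (swapAt j z) ∂(pairLaw μ n) = ∫ z, f z ∂(pairLaw μ n) := by
  have h := measurePreserving_swapAt μ j
  conv_rhs => rw [← h.map_eq, integral_map h.measurable.aemeasurable hf.1.aestronglyMeasurable]

lemma integral_mix_univ_mul_mix_empty (f g : (Fin n → A) → ℝ) :
    ∫ z, f (mix Finset.univ z) * g (mix ∅ z) ∂(pairLaw μ n) =
      (∫ x, f x ∂(Measure.pi fun _ => μ)) * ∫ x, g x ∂(Measure.pi fun _ => μ) := by
  have h := measurePreserving_arrowProdEquivProdArrow A A (Fin n) (fun _ => μ) (fun _ => μ)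
  have h2 := h.integral_comp (MeasurableEquiv.measurableEmbedding _)
    (fun p : (Fin n → A) × (Fin n → A) => f p.2 * g p.1)
  rw [← mul_comm, ← integral_prod_mul g f]
  simp only [mul_comm (f _)] at h2 ⊢
  rw [← h2]
  congr 1; funext z
  have h0 : mix ∅ z = fun i => (z i).1 := by funext i; simp [mix]
  have h1 : mix Finset.univ z = fun i => (z i).2 := by funext i; simp [mix]
  simp [h0, h1, MeasurableEquiv.arrowProdEquivProdArrow, Equiv.arrowProdEquivProdArrow]

lemma BddMeas.seqDiff {g : (Fin n → A) → ℝ} (hg : BddMeas g) (j : Fin n) :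
    BddMeas (seqDiff g j) :=
  (hg.comp (measurable_mix _)).sub (hg.comp (measurable_mix _))

lemma BddMeas.coordDiff {g : (Fin n → A) → ℝ} (hg : BddMeas g) (j : Fin n) :
    BddMeas (coordDiff g j) :=
  (hg.comp (measurable_mix _)).sub (hg.comp (measurable_mix _))

/-- An antisymmetric function times a function of the first coordinates. -/
lemma integral_antisymm_mul {D : (Fin n → A × A) → ℝ} (hD : BddMeas D) {j : Fin n}
    (hj : ∀ z, D (swapAt j z) = -D z) {f : (Fin n → A) → ℝ} (hf : BddMeas f) :
    ∫ z, D z * f (mix ∅ z) ∂(pairLaw μ n) =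
      (1 / 2) * ∫ z, D z * coordDiff f j z ∂(pairLaw μ n) := by
  have h0 : BddMeas fun z => D z * f (mix ∅ z) := hD.mul (hf.comp (measurable_mix _))
  have h1 : BddMeas fun z => D z * f (mix {j} z) := hD.mul (hf.comp (measurable_mix _))
  -- The swap preserves the law, flips the sign of `D` and moves `mix ∅` to `mix {j}`; averaging the
  -- two forms produces the factor `1 / 2`.
  have h2 : ∫ z, D z * f (mix {j} z) ∂(pairLaw μ n) = -∫ z, D z * f (mix ∅ z) ∂(pairLaw μ n) := by
    rw [← integral_comp_swapAt μ h0 j, ← integral_neg]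
    congr 1; funext z
    rw [hj, mix_empty_swapAt]; ring
  simp only [coordDiff, mul_sub]
  rw [integral_sub (h0.integrable _) (h1.integrable _), h2]
  ring

/-- The product of means is the mean of `f (mix univ) * g (mix ∅)`, the two vectors being
independent. So the covariance is that of a telescoping difference of `f` against `g (mix ∅)`, and
each term is symmetrised by the swap at its coordinate. -/
theorem covariance_eq_sum_diff {f g : (Fin n → A) → ℝ} (hf : BddMeas f) (hg : BddMeas g) :
    (∫ x, f x * g x ∂(Measure.pi fun _ => μ)) -
        (∫ x, f x ∂(Measure.pi fun _ => μ)) * ∫ x, g x ∂(Measure.pi fun _ => μ) =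
      (1 / 2) * ∑ j, ∫ z, seqDiff f j z * coordDiff g j z ∂(pairLaw μ n) := by
  have hg0 := hg.comp (measurable_mix (A := A) (n := n) ∅)
  rw [← integral_mix_univ_mul_mix_empty, ← integral_comp_mix μ (hf.mul hg) ∅,
    ← integral_sub (((hf.mul hg).comp (measurable_mix _)).integrable _)
      (((hf.comp (measurable_mix _)).mul hg0).integrable _), Finset.mul_sum]
  simp only [← integral_antisymm_mul μ (hf.seqDiff _) (seqDiff_swapAt f _) hg]
  rw [← integral_finsetSum _ fun j _ => ((hf.seqDiff j).mul hg0).integrable _]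
  congr 1; funext z
  rw [← Finset.sum_mul, sum_seqDiff]; ring

/-- The Efron–Stein inequality for functions with bounded differences. -/
theorem efron_stein {F : (Fin n → A) → ℝ} (hF : BddMeas F) {c : ℝ}
    (hc : ∀ x i a, |F x - F (Function.update x i a)| ≤ c) :
    (∫ x, F x * F x ∂(Measure.pi fun _ => μ)) - (∫ x, F x ∂(Measure.pi fun _ => μ)) ^ 2 ≤
      n / 2 * c ^ 2 := by
  rw [sq, covariance_eq_sum_diff μ hF hF]
  have : ∀ j : Fin n, ∫ z, seqDiff F j z * coordDiff F j z ∂(pairLaw μ n) ≤ c ^ 2 := fun j => by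
    have h : ∀ z, seqDiff F j z * coordDiff F j z ≤ c ^ 2 := fun z => by
      have h1 : |seqDiff F j z| ≤ c := by rw [seqDiff, mix_insert]; exact hc _ _ _
      have h2 : |coordDiff F j z| ≤ c := by rw [coordDiff, mix_singleton]; exact hc _ _ _
      refine (le_abs_self _).trans ?_
      rw [abs_mul, sq]
      exact mul_le_mul h1 h2 (abs_nonneg _) ((abs_nonneg _).trans h1)
    calc _ ≤ ∫ _, c ^ 2 ∂(pairLaw μ n) :=
          integral_mono (((hF.seqDiff j).mul (hF.coordDiff j)).integrable _)
            (integrable_const _) h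
      _ = c ^ 2 := by simp
  have := Finset.sum_le_sum fun j (_ : j ∈ Finset.univ) => this j
  simp only [Finset.sum_const, Finset.card_univ, Fintype.card_fin, nsmul_eq_mul] at this
  linarith

/-- Nonnegativity of the variance of `|f|`. -/
lemma sq_integral_abs_le {E : Type*} [MeasurableSpace E] (ν : Measure E) [IsProbabilityMeasure ν]
    {f : E → ℝ} (hf : BddMeas f) : (∫ x, |f x| ∂ν) ^ 2 ≤ ∫ x, f x * f x ∂ν := by
  set m := ∫ x, |f x| ∂ν with hm
  have h : 0 ≤ ∫ x, (|f x| - m) * (|f x| - m) ∂ν := integral_nonneg fun x => mul_self_nonneg _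
  have h1 : ∀ x, (|f x| - m) * (|f x| - m) = f x * f x - 2 * m * |f x| + m ^ 2 := fun x => by
    linear_combination abs_mul_abs_self (f x)
  simp only [h1] at h
  rw [integral_add (((hf.mul hf).sub ((BddMeas.const _).mul hf.abs)).integrable ν)
    (integrable_const _), integral_sub ((hf.mul hf).integrable ν)
    (((BddMeas.const _).mul hf.abs).integrable ν), integral_const_mul, ← hm] at h
  simp at h
  linarith

lemma integral_abs_sub_integral_le {F : (Fin n → A) → ℝ} (hF : BddMeas F) {c : ℝ} (hc0 : 0 ≤ c)
    (hc : ∀ x i a, |F x - F (Function.update x i a)| ≤ c) {m : ℝ}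
    (hm : ∫ x, F x ∂(Measure.pi fun _ => μ) = m) :
    ∫ x, |F x - m| ∂(Measure.pi fun _ => μ) ≤ √(n / 2) * c := by
  have hG : BddMeas fun x => F x - m := hF.sub (BddMeas.const m)
  have h1 := sq_integral_abs_le (Measure.pi fun _ : Fin n => μ) hG
  have h2 := efron_stein μ hG (c := c) fun x i a => by simpa using hc x i a
  have h3 : ∫ x, (F x - m) ∂(Measure.pi fun _ : Fin n => μ) = 0 := by
    rw [integral_sub (hF.integrable _) (integrable_const _), hm]; simp
  rw [h3] at h2
  refine abs_le_of_sq_le_sq' (b := √(n / 2) * c) ?_ (by positivity) |>.2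
  rw [mul_pow, sq_sqrt (by positivity)]
  linarith

end Independent

/-! ### Stein's method for the Kolmogorov distance -/

section SteinBound

variable {A : Type*} [MeasurableSpace A] {n : ℕ} (μ : Measure A) [IsProbabilityMeasure μ]

lemma BddMeas.steinSol_comp {E : Type*} [MeasurableSpace E] {W : E → ℝ} (hW : BddMeas W) (z : ℝ) :
    BddMeas fun x => steinSol z (W x) := by
  obtain ⟨hm, C, hC⟩ := hW
  obtain ⟨B, hB⟩ := (isCompact_Icc (a := -C) (b := C)).exists_bound_of_continuousOn
    (continuous_steinSol z).continuousOn
  exact ⟨(continuous_steinSol z).measurable.comp hm, B, fun x => hB _ (abs_le.1 (hC x))⟩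

lemma BddMeas.ite_le {E : Type*} [MeasurableSpace E] {W : E → ℝ} (hW : BddMeas W) (z : ℝ) :
    BddMeas fun x => if W x ≤ z then (1 : ℝ) else 0 :=
  ⟨Measurable.ite (measurableSet_le hW.1 measurable_const) measurable_const measurable_const, 1,
    fun x => by dsimp only; split_ifs <;> simp⟩

lemma BddMeas.steinMono_comp {E : Type*} [MeasurableSpace E] {W : E → ℝ} (hW : BddMeas W) (z : ℝ) :
    BddMeas fun x => steinMono z (W x) :=
  (hW.mul (hW.steinSol_comp z)).sub (hW.ite_le z)

lemma abs_stein_deriv_le (z w : ℝ) :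
    |w * steinSol z w + (if w ≤ z then 1 else 0) - (gaussianReal 0 1).real (Iic z)| ≤ 1 := by
  have h1 := le_mul_steinSol z w
  have h2 := mul_steinSol_le z w
  rcases le_or_gt w z with h | h
  · rw [if_pos h, abs_le]; constructor <;> linarith
  · rw [if_neg h.not_ge, abs_le]; constructor <;> linarith

variable {W : (Fin n → A) → ℝ}

/-- Bounds the Taylor remainder. The absolute value on the right stays outside the sum over `j`, so
cancellation between coordinates is kept. -/
theorem abs_integral_stein_sub_le (hW : BddMeas W) (z : ℝ) :
    |∑ j, ∫ y, seqDiff W j y * (coordDiff (fun x => steinSol z (W x)) j y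
        - coordDiff W j y * (W (mix ∅ y) * steinSol z (W (mix ∅ y))
          + (if W (mix ∅ y) ≤ z then 1 else 0) - (gaussianReal 0 1).real (Iic z))) ∂(pairLaw μ n)| ≤
      2 * ∫ y, |∑ j, |seqDiff W j y| * coordDiff W j y| ∂(pairLaw μ n) := by
  set p := (gaussianReal 0 1).real (Iic z)
  have hk := hW.steinMono_comp z
  have hkc : BddMeas fun x => steinMono z (W x) - (p - 1) := hk.sub (BddMeas.const _)
  have hS : ∀ j, BddMeas fun y => |seqDiff W j y| * coordDiff W j y := fun j =>
    (hW.seqDiff j).abs.mul (hW.coordDiff j)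
  have hkm := hkc.comp (measurable_mix (A := A) (n := n) ∅)
  have h1 : ∀ j, |∫ y, seqDiff W j y * (coordDiff (fun x => steinSol z (W x)) j y
        - coordDiff W j y * (W (mix ∅ y) * steinSol z (W (mix ∅ y))
          + (if W (mix ∅ y) ≤ z then 1 else 0) - p)) ∂(pairLaw μ n)| ≤
      2 * ∫ y, |seqDiff W j y| * coordDiff W j y * (steinMono z (W (mix ∅ y)) - (p - 1))
        ∂(pairLaw μ n) := fun j => by
    -- Read backwards, symmetrisation applies: `|D_j| Δ_j` is antisymmetric, so twice its integral
    -- against the value of `steinMono` is its integral against the increment.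
    rw [integral_antisymm_mul μ (hS j) (j := j) (fun y => by
      rw [seqDiff_swapAt, coordDiff_swapAt, abs_neg]; ring) hkc, ← mul_assoc]
    norm_num only
    rw [one_mul]
    refine abs_integral_le_integral_abs.trans ?_
    refine integral_mono_of_nonneg (ae_of_all _ fun y => abs_nonneg _)
      (((hS j).mul (hkc.coordDiff j)).integrable _) (ae_of_all _ fun y => ?_)
    have := abs_steinSol_sub_sub_le z (W (mix ∅ y)) (W (mix {j} y))
    simp only [abs_mul, mul_assoc]
    refine mul_le_mul_of_nonneg_left ?_ (abs_nonneg _)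
    simpa only [coordDiff, sub_sub_sub_cancel_right] using this
  calc _ ≤ ∑ j, |_| := Finset.abs_sum_le_sum_abs _ _
    _ ≤ ∑ j, 2 * ∫ y, |seqDiff W j y| * coordDiff W j y * (steinMono z (W (mix ∅ y)) - (p - 1))
        ∂(pairLaw μ n) := Finset.sum_le_sum fun j _ => h1 j
    _ = 2 * ∫ y, (∑ j, |seqDiff W j y| * coordDiff W j y) * (steinMono z (W (mix ∅ y)) - (p - 1))
        ∂(pairLaw μ n) := by
      rw [← Finset.mul_sum, ← integral_finsetSum _ fun j _ => ((hS j).mul hkm).integrable _]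
      simp only [Finset.sum_mul]
    _ ≤ _ := by
      refine mul_le_mul_of_nonneg_left ?_ zero_le_two
      have hSS : BddMeas fun y => ∑ j, |seqDiff W j y| * coordDiff W j y :=
        BddMeas.sum _ fun j _ => hS j
      refine integral_mono ((hSS.mul hkm).integrable _) (hSS.abs.integrable _) fun y => ?_
      refine (le_abs_self _).trans ?_
      rw [abs_mul]
      exact mul_le_of_le_one_right (abs_nonneg _) (steinMono_sub_mem z _)

/-- A Berry–Esseen bound for functions of independent variables. -/
theorem abs_measure_le_sub_gaussian_le (hW : BddMeas W)
    (h0 : ∫ x, W x ∂(Measure.pi fun _ => μ) = 0)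
    (z : ℝ) :
    |(Measure.pi fun _ => μ).real {x | W x ≤ z} - (gaussianReal 0 1).real (Iic z)| ≤
      (∫ y, |(1 / 2) * (∑ j, seqDiff W j y * coordDiff W j y) - 1| ∂(pairLaw μ n))
      + ∫ y, |∑ j, |seqDiff W j y| * coordDiff W j y| ∂(pairLaw μ n) := by
  set p := (gaussianReal 0 1).real (Iic z) with hp
  have hphi := hW.steinSol_comp z
  have hind := hW.ite_le z
  -- By Stein's equation `ψ` stands for the derivative of `steinSol z` at `W`; its mean minus that
  -- of `W * steinSol z W` is the difference of distribution functions.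
  set ψ : (Fin n → A) → ℝ := fun x =>
    W x * steinSol z (W x) + (if W x ≤ z then 1 else 0) - p with hψ
  have hψb : BddMeas ψ := ((hW.mul hphi).add hind).sub (BddMeas.const p)
  have hψm := hψb.comp (measurable_mix (A := A) (n := n) ∅)
  have hDΔ : ∀ j, BddMeas fun y => seqDiff W j y * coordDiff W j y := fun j =>
    (hW.seqDiff j).mul (hW.coordDiff j)
  have hT : BddMeas fun y => (1 / 2) * (∑ j, seqDiff W j y * coordDiff W j y) - 1 :=
    ((BddMeas.const _).mul (BddMeas.sum _ fun j _ => hDΔ j)).sub (BddMeas.const _)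
  have e1 : (Measure.pi fun _ => μ).real {x | W x ≤ z} =
      ∫ x, (if W x ≤ z then (1 : ℝ) else 0) ∂(Measure.pi fun _ => μ) := by
    have hm : MeasurableSet {x | W x ≤ z} := measurableSet_le hW.1 measurable_const
    rw [← integral_indicator_one hm]
    congr 1
  have e2 : ∫ x, ψ x ∂(Measure.pi fun _ => μ) = (∫ x, W x * steinSol z (W x)
      ∂(Measure.pi fun _ => μ)) + (Measure.pi fun _ => μ).real {x | W x ≤ z} - p := by
    rw [hψ, integral_sub (((hW.mul hphi).add hind).integrable _) (integrable_const _),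
      integral_add ((hW.mul hphi).integrable _) (hind.integrable _), e1]
    simp
  have e3 := covariance_eq_sum_diff μ hW hphi
  rw [h0, zero_mul, sub_zero] at e3
  have e4 := abs_integral_stein_sub_le μ hW z
  have e5 : ∑ j, ∫ y, seqDiff W j y * (coordDiff (fun x => steinSol z (W x)) j y
        - coordDiff W j y * ψ (mix ∅ y)) ∂(pairLaw μ n)
      = (∑ j, ∫ y, seqDiff W j y * coordDiff (fun x => steinSol z (W x)) j y ∂(pairLaw μ n))
        - ∫ y, (∑ j, seqDiff W j y * coordDiff W j y) * ψ (mix ∅ y) ∂(pairLaw μ n) := by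
    simp only [Finset.sum_mul]
    rw [integral_finsetSum _ fun j _ => ((hDΔ j).mul hψm).integrable _, ← Finset.sum_sub_distrib]
    refine Finset.sum_congr rfl fun j _ => ?_
    rw [← integral_sub (((hW.seqDiff j).mul (hphi.coordDiff j)).integrable _)
      (((hDΔ j).mul hψm).integrable _)]
    congr 1; funext y; ring
  have e6 : ∫ y, ((1 / 2) * (∑ j, seqDiff W j y * coordDiff W j y) - 1) * ψ (mix ∅ y)
      ∂(pairLaw μ n) = (1 / 2) * (∫ y, (∑ j, seqDiff W j y * coordDiff W j y) * ψ (mix ∅ y)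
        ∂(pairLaw μ n)) - ∫ x, ψ x ∂(Measure.pi fun _ => μ) := by
    simp only [sub_mul, one_mul, mul_assoc]
    rw [integral_sub (((BddMeas.const _).mul ((BddMeas.sum _ fun j _ => hDΔ j).mul
      hψm)).integrable _) (hψm.integrable _), integral_const_mul, integral_comp_mix μ hψb]
  have e7 : |∫ y, ((1 / 2) * (∑ j, seqDiff W j y * coordDiff W j y) - 1) * ψ (mix ∅ y)
      ∂(pairLaw μ n)| ≤
      ∫ y, |(1 / 2) * (∑ j, seqDiff W j y * coordDiff W j y) - 1| ∂(pairLaw μ n) := by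
    refine abs_integral_le_integral_abs.trans ?_
    refine integral_mono ((hT.mul hψm).abs.integrable _) (hT.abs.integrable _) fun y => ?_
    simp only [abs_mul]
    exact mul_le_of_le_one_right (abs_nonneg _) (abs_stein_deriv_le z _)
  rw [e5] at e4
  rw [abs_le] at e4 e7 ⊢
  constructor <;> linarith [e4.1, e4.2, e7.1, e7.2]

/-- Half of `∑ D_j Δ_j` has mean `Var W = 1`, and `∑ |D_j| Δ_j` has mean `0` by antisymmetry.
Efron–Stein on the space of pairs gives `√(n/2)` times `c/2` and `c` respectively. -/
theorem abs_measure_le_sub_gaussian_le_of_bounded_differences (hW : BddMeas W)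
    (h0 : ∫ x, W x ∂(Measure.pi fun _ => μ) = 0)
    (h1 : ∫ x, W x * W x ∂(Measure.pi fun _ => μ) = 1) {c : ℝ} (hc0 : 0 ≤ c)
    (hT : ∀ y i a, |∑ j, seqDiff W j y * coordDiff W j y - ∑ j, seqDiff W j (Function.update y i a)
      * coordDiff W j (Function.update y i a)| ≤ c)
    (hS : ∀ y i a, |∑ j, |seqDiff W j y| * coordDiff W j y -
      ∑ j, |seqDiff W j (Function.update y i a)| * coordDiff W j (Function.update y i a)| ≤ c)
    (z : ℝ) :
    |(Measure.pi fun _ => μ).real {x | W x ≤ z} - (gaussianReal 0 1).real (Iic z)| ≤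
      √(n / 2) * (3 / 2 * c) := by
  have hDΔ : ∀ j, BddMeas fun y => seqDiff W j y * coordDiff W j y := fun j =>
    (hW.seqDiff j).mul (hW.coordDiff j)
  have hSj : ∀ j, BddMeas fun y => |seqDiff W j y| * coordDiff W j y := fun j =>
    (hW.seqDiff j).abs.mul (hW.coordDiff j)
  have hTB : BddMeas fun y => (1 / 2) * (∑ j, seqDiff W j y * coordDiff W j y) :=
    (BddMeas.const _).mul (BddMeas.sum _ fun j _ => hDΔ j)
  have hSB : BddMeas fun y => ∑ j, |seqDiff W j y| * coordDiff W j y :=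
    BddMeas.sum _ fun j _ => hSj j
  have mT : ∫ y, (1 / 2) * (∑ j, seqDiff W j y * coordDiff W j y) ∂(pairLaw μ n) = 1 := by
    rw [integral_const_mul, integral_finsetSum _ fun j _ => (hDΔ j).integrable _,
      ← covariance_eq_sum_diff μ hW hW, h1, h0]
    ring
  have mS : ∫ y, ∑ j, |seqDiff W j y| * coordDiff W j y ∂(pairLaw μ n) = 0 := by
    rw [integral_finsetSum _ fun j _ => (hSj j).integrable _]
    refine Finset.sum_eq_zero fun j _ => ?_
    have := integral_comp_swapAt μ (hSj j) j
    simp only [seqDiff_swapAt, coordDiff_swapAt, abs_neg, mul_neg, integral_neg] at this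
    linarith
  have bT := integral_abs_sub_integral_le (μ.prod μ) hTB (c := c / 2) (by positivity)
    (fun y i a => by
      rw [← mul_sub, abs_mul, abs_of_nonneg (by norm_num : (0 : ℝ) ≤ 1 / 2)]
      linarith [hT y i a]) mT
  have bS := integral_abs_sub_integral_le (μ.prod μ) hSB hc0 hS mS
  simp only [sub_zero] at bS
  refine (abs_measure_le_sub_gaussian_le μ hW h0 z).trans ?_
  linarith

end SteinBound

/-! ### Sums of locally dependent functions -/

section LocalDependence

variable {A : Type*} {n : ℕ} {𝓘 : Type*} {h : 𝓘 → (Fin n → A) → ℝ}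
  {N : 𝓘 → Finset (Fin n)}

/-- Each `h I` is a `[0,1]`-valued function of the coordinates in `N I`. -/
structure IsLocalFamily (h : 𝓘 → (Fin n → A) → ℝ) (N : 𝓘 → Finset (Fin n)) : Prop where
  nonneg : ∀ I x, 0 ≤ h I x
  le_one : ∀ I x, h I x ≤ 1
  congr : ∀ I x y, (∀ i ∈ N I, x i = y i) → h I x = h I y

namespace IsLocalFamily

lemma sub_update_eq_zero (H : IsLocalFamily h N) {I : 𝓘} {j : Fin n} (hj : j ∉ N I)
    (x : Fin n → A) (a : A) : h I x - h I (Function.update x j a) = 0 := by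
  rw [sub_eq_zero]
  refine H.congr I _ _ fun i hi => ?_
  rw [Function.update_of_ne]
  rintro rfl; exact hj hi

lemma abs_sub_le (H : IsLocalFamily h N) (I : 𝓘) (x y : Fin n → A) : |h I x - h I y| ≤ 1 := by
  rw [abs_le]
  constructor <;> linarith [H.nonneg I x, H.nonneg I y, H.le_one I x, H.le_one I y]

lemma eq_mix_update (H : IsLocalFamily h N) {I : 𝓘} {i : Fin n} (hi : i ∉ N I)
    (s : Finset (Fin n)) (y : Fin n → A × A) (a : A × A) :
    h I (mix s (Function.update y i a)) = h I (mix s y) :=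
  H.congr I _ _ fun k hk => mix_update_of_eq s y i a (by rintro rfl; exact hi hk)

variable [Fintype 𝓘]

lemma abs_sum_sub_update_le (H : IsLocalFamily h N) {Q : ℝ}
    (hQ : ∀ j, ∑ I, (if j ∈ N I then (1 : ℝ) else 0) ≤ Q) (x : Fin n → A) (j : Fin n) (a : A) :
    |∑ I, h I x - ∑ I, h I (Function.update x j a)| ≤ Q := by
  rw [← Finset.sum_sub_distrib]
  refine (Finset.abs_sum_le_sum_abs _ _).trans ((Finset.sum_le_sum fun I _ => ?_).trans (hQ j))
  split_ifs with hj
  · exact H.abs_sub_le _ _ _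
  · rw [H.sub_update_eq_zero hj, abs_zero]

/-- A summand contributes only if it depends on `j`, else its increment vanishes, and on `i`, else
the update is invisible. The contribution is a difference of two increments of size at most `1`. -/
lemma abs_sum_diff_update_le (H : IsLocalFamily h N) (s t : Finset (Fin n)) (j : Fin n)
    (hst : t = insert j s) (y : Fin n → A × A) (i : Fin n) (a : A × A) :
    |(∑ I, h I (mix s y) - ∑ I, h I (mix t y)) - (∑ I, h I (mix s (Function.update y i a))
      - ∑ I, h I (mix t (Function.update y i a)))| ≤
      ∑ I, (if j ∈ N I then (1 : ℝ) else 0) * (if i ∈ N I then 2 else 0) := by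
  subst hst
  simp only [← Finset.sum_sub_distrib]
  refine (Finset.abs_sum_le_sum_abs _ _).trans (Finset.sum_le_sum fun I _ => ?_)
  split_ifs with hj hi hi
  · refine (abs_sub _ _).trans ?_
    linarith [H.abs_sub_le I (mix s y) (mix (insert j s) y), H.abs_sub_le I
      (mix s (Function.update y i a)) (mix (insert j s) (Function.update y i a))]
  · simp [H.eq_mix_update hi]
  · simp [mix_insert, H.sub_update_eq_zero hj]
  · simp [mix_insert, H.sub_update_eq_zero hj]

/-- Summing over `j` first counts the at most `s` coordinates of `N I`; at most `Q` sets then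
contain `i`. -/
lemma sum_sum_le {Q s : ℝ} (hs : ∀ I, ((N I).card : ℝ) ≤ s)
    (hQ : ∀ j, ∑ I, (if j ∈ N I then (1 : ℝ) else 0) ≤ Q) (hs0 : 0 ≤ s) (i : Fin n) :
    ∑ j, ∑ I, (if j ∈ N I then (1 : ℝ) else 0) * (if i ∈ N I then 2 else 0) ≤ 2 * s * Q := by
  rw [Finset.sum_comm]
  simp only [← Finset.sum_mul]
  calc _ ≤ ∑ I, 2 * s * (if i ∈ N I then (1 : ℝ) else 0) := by
        refine Finset.sum_le_sum fun I _ => ?_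
        have : ∑ j, (if j ∈ N I then (1 : ℝ) else 0) = (N I).card := by simp
        rw [this]
        split_ifs <;> linarith [hs I]
    _ ≤ _ := by
        rw [← Finset.mul_sum]
        exact mul_le_mul_of_nonneg_left (hQ i) (by positivity)

end IsLocalFamily

lemma abs_mul_sub_mul_le {D D' E E' d e Q : ℝ} (h1 : |D - D'| ≤ d) (h2 : |E - E'| ≤ e)
    (hD : |D'| ≤ Q) (hE : |E| ≤ Q) : |D * E - D' * E'| ≤ Q * d + Q * e := by
  have : D * E - D' * E' = E * (D - D') + D' * (E - E') := by ring
  rw [this]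
  refine (abs_add_le _ _).trans ?_
  rw [abs_mul, abs_mul]
  have hQ : 0 ≤ Q := (abs_nonneg _).trans hD
  gcongr

variable [MeasurableSpace A] [Fintype 𝓘]

/-- Kolmogorov bound for sums of locally dependent functions of independent variables. -/
theorem IsLocalFamily.abs_measure_le_sub_gaussian_le (H : IsLocalFamily h N)
    (hm : ∀ I, Measurable (h I)) (μ : Measure A) [IsProbabilityMeasure μ] {Q s : ℝ}
    (hs : ∀ I, ((N I).card : ℝ) ≤ s) (hs0 : 0 ≤ s) (hQ0 : 0 ≤ Q)
    (hQ : ∀ j, ∑ I, (if j ∈ N I then (1 : ℝ) else 0) ≤ Q) {m V : ℝ}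
    (hmean : ∫ x, ∑ I, h I x ∂(Measure.pi fun _ => μ) = m)
    (hvar : ∫ x, (∑ I, h I x - m) ^ 2 ∂(Measure.pi fun _ => μ) = V) (hV : 0 < V) (z : ℝ) :
    |(Measure.pi fun _ => μ).real {x | (∑ I, h I x - m) / √V ≤ z}
      - (gaussianReal 0 1).real (Iic z)| ≤ 6 * s * Q ^ 2 * √(n / 2) / V := by
  have hG : BddMeas fun x => ∑ I, h I x := BddMeas.sum _ fun I _ =>
    ⟨hm I, 1, fun x => by rw [abs_of_nonneg (H.nonneg I x)]; exact H.le_one I x⟩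
  set W : (Fin n → A) → ℝ := fun x => (∑ I, h I x - m) / √V with hWdef
  have hsV : 0 < √V := sqrt_pos.2 hV
  have hW : BddMeas W := by
    simpa only [hWdef, div_eq_mul_inv] using (hG.sub (BddMeas.const m)).mul (BddMeas.const (√V)⁻¹)
  have h0 : ∫ x, W x ∂(Measure.pi fun _ => μ) = 0 := by
    rw [hWdef, integral_div, integral_sub (hG.integrable _) (integrable_const _), hmean]; simp
  have h1 : ∫ x, W x * W x ∂(Measure.pi fun _ => μ) = 1 := by
    have : ∀ x, W x * W x = (∑ I, h I x - m) ^ 2 / V := fun x => by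
      rw [hWdef, ← sq, div_pow, sq_sqrt hV.le]
    simp only [this]
    rw [integral_div, hvar, div_self hV.ne']
  have seqW : ∀ j y, seqDiff W j y =
      (∑ I, h I (mix (Finset.Iio j) y) - ∑ I, h I (mix (insert j (Finset.Iio j)) y)) / √V := by
    intro j y; simp only [seqDiff, hWdef]; ring
  have coordW : ∀ j y, coordDiff W j y =
      (∑ I, h I (mix ∅ y) - ∑ I, h I (mix {j} y)) / √V := by
    intro j y; simp only [coordDiff, hWdef]; ring
  have bseq : ∀ j y, |seqDiff W j y| ≤ Q / √V := fun j y => by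
    rw [seqW, abs_div, abs_of_pos hsV, mix_insert]
    gcongr; exact H.abs_sum_sub_update_le hQ _ _ _
  have bcoord : ∀ j y, |coordDiff W j y| ≤ Q / √V := fun j y => by
    rw [coordW, abs_div, abs_of_pos hsV, mix_singleton]
    gcongr; exact H.abs_sum_sub_update_le hQ _ _ _
  set R : Fin n → Fin n → ℝ := fun i j =>
    (∑ I, (if j ∈ N I then (1 : ℝ) else 0) * (if i ∈ N I then 2 else 0)) / √V with hR
  have dseq : ∀ j y i a, |seqDiff W j y - seqDiff W j (Function.update y i a)| ≤ R i j := by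
    intro j y i a
    rw [seqW, seqW, ← sub_div, abs_div, abs_of_pos hsV]
    exact div_le_div_of_nonneg_right (H.abs_sum_diff_update_le _ _ j rfl y i a) hsV.le
  have dcoord : ∀ j y i a, |coordDiff W j y - coordDiff W j (Function.update y i a)| ≤ R i j := by
    intro j y i a
    rw [coordW, coordW, ← sub_div, abs_div, abs_of_pos hsV]
    exact div_le_div_of_nonneg_right (H.abs_sum_diff_update_le _ _ j rfl y i a) hsV.le
  -- Each factor is at most `Q / √V` and varies by `R i j`. The resulting `4 s Q² / V`, multiplied
  -- by `3/2`, gives the constant `6`.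
  have hsum : ∀ i, ∑ j, (Q / √V * R i j + Q / √V * R i j) ≤ 4 * s * Q ^ 2 / V := fun i => by
    have := IsLocalFamily.sum_sum_le hs hQ hs0 i
    have hq : 0 ≤ Q / √V := by positivity
    calc _ = 2 * (Q / √V) * ((∑ j, ∑ I, (if j ∈ N I then (1 : ℝ) else 0) *
          (if i ∈ N I then 2 else 0)) / √V) := by
          rw [Finset.sum_div, Finset.mul_sum]
          exact Finset.sum_congr rfl fun j _ => by rw [hR]; ring
      _ ≤ 2 * (Q / √V) * (2 * s * Q / √V) := by gcongr
      _ = 4 * s * Q ^ 2 / (√V) ^ 2 := by ring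
      _ = _ := by rw [sq_sqrt hV.le]
  have key := abs_measure_le_sub_gaussian_le_of_bounded_differences μ hW h0 h1
    (c := 4 * s * Q ^ 2 / V) (by positivity) (fun y i a => ?_) (fun y i a => ?_) z
  · refine key.trans (le_of_eq ?_); ring
  · rw [← Finset.sum_sub_distrib]
    refine (Finset.abs_sum_le_sum_abs _ _).trans (le_trans (Finset.sum_le_sum fun j _ => ?_)
      (hsum i))
    exact abs_mul_sub_mul_le (dseq j y i a) (dcoord j y i a) (bseq j _) (bcoord j _)
  · rw [← Finset.sum_sub_distrib]
    refine (Finset.abs_sum_le_sum_abs _ _).trans (le_trans (Finset.sum_le_sum fun j _ => ?_)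
      (hsum i))
    -- The absolute value is 1-Lipschitz, so the same increment bound serves.
    exact abs_mul_sub_mul_le ((abs_abs_sub_abs_le_abs_sub _ _).trans (dseq j y i a))
      (dcoord j y i a) (by rw [abs_abs]; exact bseq j _) (bcoord j _)

end LocalDependence

end NormalApproximation

section Patterns

open Set
open scoped Topology

/-! ### Averages over a conjugacy class -/

section Average

lemma integral_uniformOn_finset {E : Type*} [Fintype E] [DecidableEq E] [MeasurableSpace E]
    [MeasurableSingletonClass E] (s : Finset E) (G : E → ℝ) :
    ∫ x, G x ∂(uniformOn (s : Set E)) = (s.card : ℝ)⁻¹ * ∑ x ∈ s, G x := by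
  have h : ∀ x, (uniformOn (s : Set E)).real {x} = if x ∈ s then (s.card : ℝ)⁻¹ else 0 := fun x => by
    rw [measureReal_def, ← Finset.coe_singleton, uniformOn_apply_finset]
    split_ifs with hx
    · rw [Finset.inter_singleton_of_mem hx]; simp
    · rw [Finset.inter_singleton_of_notMem hx]; simp
  rw [integral_fintype Integrable.of_finite]
  simp only [h, smul_eq_mul, ite_mul, zero_mul, Finset.sum_ite_mem, Finset.univ_inter,
    Finset.mul_sum]

variable {n : ℕ}

open Classical in
/-- Averaging over a conjugacy class is averaging over all conjugators. -/
lemma card_mul_sum_conjClass (t : n.Partition) {ρ : Equiv.Perm (Fin n)} (hρ : IsCyclicOfType t ρ)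
    (G : Equiv.Perm (Fin n) → ℝ) :
    (Fintype.card (Equiv.Perm (Fin n)) : ℝ) * ∑ κ with IsCyclicOfType t κ, G κ =
      ((Finset.univ.filter fun κ => IsCyclicOfType t κ).card : ℝ) * ∑ s, G (s * ρ * s⁻¹) := by
  have hconj : ∀ s κ : Equiv.Perm (Fin n), IsCyclicOfType t (s * κ * s⁻¹) ↔ IsCyclicOfType t κ :=
    fun s κ => by
      have : IsConj κ (s * κ * s⁻¹) := isConj_iff.2 ⟨s, rfl⟩
      rw [IsCyclicOfType, IsCyclicOfType, Equiv.Perm.partition_eq_of_isConj.1 this]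
  have h1 : ∀ s : Equiv.Perm (Fin n), ∑ κ with IsCyclicOfType t κ, G (s * κ * s⁻¹) =
      ∑ κ with IsCyclicOfType t κ, G κ := fun s => by
    refine Finset.sum_bij' (fun κ _ => s * κ * s⁻¹) (fun κ _ => s⁻¹ * κ * s) ?_ ?_ ?_ ?_ ?_
    · intro κ hκ; simpa [hconj] using hκ
    · intro κ hκ
      have := hconj s⁻¹ κ
      rw [inv_inv] at this
      simpa [this] using hκ
    · intro κ _; group
    · intro κ _; group
    · intro κ _; rfl
  have h2 : ∀ κ, IsCyclicOfType t κ → ∑ s : Equiv.Perm (Fin n), G (s * κ * s⁻¹) =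
      ∑ s, G (s * ρ * s⁻¹) := fun κ hκ => by
    have : IsConj ρ κ := by
      rw [Equiv.Perm.partition_eq_of_isConj, Nat.Partition.ext_iff, ← hρ.trans hκ.symm]
    obtain ⟨c, rfl⟩ := isConj_iff.1 this
    rw [← Equiv.sum_comp (Equiv.mulRight c) fun s => G (s * ρ * s⁻¹)]
    refine Finset.sum_congr rfl fun s _ => ?_
    congr 1
  -- A double sum over conjugators and class members, evaluated in both orders: the inner sum is
  -- constant either way.
  calc _ = ∑ s : Equiv.Perm (Fin n), ∑ κ with IsCyclicOfType t κ, G (s * κ * s⁻¹) := by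
        rw [Finset.sum_congr rfl fun s _ => h1 s, Finset.sum_const, Finset.card_univ, nsmul_eq_mul]
    _ = _ := by
        rw [Finset.sum_comm, Finset.sum_congr rfl fun κ hκ => h2 κ (Finset.mem_filter.1 hκ).2,
          Finset.sum_const, nsmul_eq_mul]

end Average

/-! ### Patterns among independent uniform points -/

section Geometric

variable {n r : ℕ}

/-- The points `(x i, x (ρ i))`, `i ∈ I`, form the pattern `π`. -/
def PointPattern (π : Equiv.Perm (Fin r)) (ρ : Equiv.Perm (Fin n)) (I : Finset (Fin n))
    (x : Fin n → ℝ) : Prop :=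
  ∃ e : Fin r → Fin n, (∀ j, e j ∈ I) ∧ (∀ j k, j < k → x (e j) < x (e k)) ∧
    ∀ j k, π j > π k ↔ x (ρ (e k)) < x (ρ (e j))

lemma measurableSet_pointPattern (π : Equiv.Perm (Fin r)) (ρ : Equiv.Perm (Fin n))
    (I : Finset (Fin n)) : MeasurableSet {x | PointPattern π ρ I x} := by
  have hlt : ∀ i j : Fin n, Measurable fun x : Fin n → ℝ => x i < x j := fun i j =>
    measurableSet_setOfPred.1 (measurableSet_lt (measurable_pi_apply i) (measurable_pi_apply j))
  refine measurableSet_setOfPred.2 (Measurable.exists fun e => ?_)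
  refine measurable_const.and (Measurable.and ?_ ?_)
  · exact Measurable.forall fun j => Measurable.forall fun k => measurable_const.imp (hlt _ _)
  · exact Measurable.forall fun j => Measurable.forall fun k => measurable_const.iff (hlt _ _)

/-- If `s` ranks `x`, the points `(x i, x (ρ i))` are ordered like `(s i, s (ρ i))`, which trace the
graph of `s * ρ * s⁻¹`. The witness `e` is forced to be the increasing enumeration. -/
lemma pointPattern_iff_inducesPattern {π : Equiv.Perm (Fin r)} {ρ s : Equiv.Perm (Fin n)}
    {I : Finset (Fin n)} {x : Fin n → ℝ} (hI : I.card = r) (hs : ∀ i j, x i < x j ↔ s i < s j) :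
    PointPattern π ρ I x ↔ InducesPattern (I.map s.toEmbedding) (s * ρ * s⁻¹) π := by
  have hc : (I.map s.toEmbedding).card = r := by rw [Finset.card_map, hI]
  constructor
  · rintro ⟨e, heI, hmono, hpat⟩
    refine ⟨hc, fun j k => ?_⟩
    have he : (fun j => s (e j)) = (I.map s.toEmbedding).orderEmbOfFin hc :=
      Finset.orderEmbOfFin_unique hc (fun j => Finset.mem_map_of_mem s.toEmbedding (heI j))
        fun j k hjk => (hs _ _).1 (hmono j k hjk)
    rw [hpat, hs, ← he]
    simp
  · rintro ⟨hc, hpat⟩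
    refine ⟨fun j => s⁻¹ ((I.map s.toEmbedding).orderEmbOfFin hc j), fun j => ?_, fun j k hjk => ?_,
      fun j k => ?_⟩
    · have := (I.map s.toEmbedding).orderEmbOfFin_mem hc j
      dsimp only
      obtain ⟨i, hi, h⟩ := Finset.mem_map.1 this
      rw [← h]; simpa using hi
    · rw [hs]; simpa using hjk
    · rw [hpat, hs]; simp

open Classical in
/-- Indicator that the points indexed by `I` form the pattern `π`. -/
noncomputable def pointInd (π : Equiv.Perm (Fin r)) (ρ : Equiv.Perm (Fin n))
    (I : (Finset.univ : Finset (Fin n)).powersetCard r) (x : Fin n → ℝ) : ℝ :=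
  if PointPattern π ρ I x then 1 else 0

lemma measurable_pointInd (π : Equiv.Perm (Fin r)) (ρ : Equiv.Perm (Fin n))
    (I : (Finset.univ : Finset (Fin n)).powersetCard r) : Measurable (pointInd π ρ I) :=
  Measurable.ite (measurableSet_pointPattern π ρ I) measurable_const measurable_const

/-- The coordinates on which `pointInd π ρ I` depends. -/
def pointSupport (ρ : Equiv.Perm (Fin n)) (I : (Finset.univ : Finset (Fin n)).powersetCard r) :
    Finset (Fin n) :=
  I ∪ (I : Finset (Fin n)).map ρ.toEmbedding

lemma isLocalFamily_pointInd (π : Equiv.Perm (Fin r)) (ρ : Equiv.Perm (Fin n)) :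
    IsLocalFamily (pointInd π ρ) (pointSupport ρ) where
  nonneg I x := by rw [pointInd]; split_ifs <;> norm_num
  le_one I x := by rw [pointInd]; split_ifs <;> norm_num
  congr I x y hxy := by
    have h : PointPattern π ρ I x ↔ PointPattern π ρ I y := by
      refine exists_congr fun e => and_congr_right fun he => ?_
      have h1 : ∀ j, x (e j) = y (e j) := fun j => hxy _ (Finset.mem_union_left _ (he j))
      have h2 : ∀ j, x (ρ (e j)) = y (ρ (e j)) := fun j =>
        hxy _ (Finset.mem_union_right _ (Finset.mem_map_of_mem ρ.toEmbedding (he j)))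
      simp only [h1, h2]
    classical
    rw [pointInd, pointInd]
    refine if_congr ?_ rfl rfl
    exact h

lemma card_pointSupport_le (ρ : Equiv.Perm (Fin n))
    (I : (Finset.univ : Finset (Fin n)).powersetCard r) :
    ((pointSupport ρ I).card : ℝ) ≤ 2 * r := by
  have hI := (Finset.mem_powersetCard.1 I.2).2
  have : (pointSupport ρ I).card ≤ r + r := by
    refine (Finset.card_union_le _ _).trans ?_
    rw [Finset.card_map, hI]
  rw [two_mul]; exact_mod_cast this

/-- Erasing `j` is injective on the sets containing it. -/
lemma card_filter_mem_powersetCard_le (j : Fin n) :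
    (((Finset.univ : Finset (Fin n)).powersetCard r).filter fun I => j ∈ I).card ≤
      (n - 1).choose (r - 1) := by
  have : (Finset.powersetCard (r - 1) (Finset.univ.erase j)).card = (n - 1).choose (r - 1) := by
    rw [Finset.card_powersetCard, Finset.card_erase_of_mem (Finset.mem_univ _), Finset.card_univ,
      Fintype.card_fin]
  rw [← this]
  refine Finset.card_le_card_of_injOn (fun I => I.erase j) (fun I hI => ?_) fun I hI J hJ h => ?_
  · obtain ⟨hI, hj⟩ := Finset.mem_filter.1 hI
    refine Finset.mem_powersetCard.2 ⟨Finset.erase_subset_erase _ (Finset.subset_univ _), ?_⟩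
    rw [Finset.card_erase_of_mem hj, (Finset.mem_powersetCard.1 hI).2]
  · have h1 := (Finset.mem_filter.1 hI).2
    have h2 := (Finset.mem_filter.1 hJ).2
    rw [← Finset.insert_erase h1, ← Finset.insert_erase h2]
    exact congrArg _ h

lemma sum_ite_mem_powersetCard_le (j : Fin n) :
    ∑ I : (Finset.univ : Finset (Fin n)).powersetCard r,
      (if j ∈ (I : Finset (Fin n)) then (1 : ℝ) else 0) ≤
        (n : ℝ) ^ (r - 1) / (r - 1).factorial := by
  rw [Finset.sum_coe_sort ((Finset.univ : Finset (Fin n)).powersetCard r)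
    fun I => if j ∈ I then (1 : ℝ) else 0, Finset.sum_boole]
  calc _ ≤ (((n - 1).choose (r - 1) : ℕ) : ℝ) := by
        exact_mod_cast card_filter_mem_powersetCard_le j
    _ ≤ (((n - 1 : ℕ) : ℝ) ^ (r - 1)) / (r - 1).factorial := Nat.choose_le_pow_div _ _
    _ ≤ _ := by gcongr; exact Nat.sub_le _ _

/-- Membership of `j` in the support forces `j` or `ρ⁻¹ j` into `I`, hence the factor `2`. -/
lemma sum_mem_pointSupport_le (ρ : Equiv.Perm (Fin n)) (j : Fin n) :
    ∑ I : (Finset.univ : Finset (Fin n)).powersetCard r,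
      (if j ∈ pointSupport ρ I then (1 : ℝ) else 0) ≤
        2 * ((n : ℝ) ^ (r - 1) / (r - 1).factorial) := by
  have h : ∀ I : (Finset.univ : Finset (Fin n)).powersetCard r,
      (if j ∈ pointSupport ρ I then (1 : ℝ) else 0) ≤
        (if j ∈ (I : Finset (Fin n)) then (1 : ℝ) else 0) +
          (if ρ⁻¹ j ∈ (I : Finset (Fin n)) then (1 : ℝ) else 0) := fun I => by
    have : j ∈ pointSupport ρ I → j ∈ (I : Finset (Fin n)) ∨ ρ⁻¹ j ∈ (I : Finset (Fin n)) := by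
      intro hj
      refine (Finset.mem_union.1 hj).imp_right fun hj => ?_
      obtain ⟨i, hi, rfl⟩ := Finset.mem_map.1 hj
      simpa using hi
    by_cases h1 : j ∈ pointSupport ρ I
    · rcases this h1 with h2 | h2 <;> simp only [h1, h2, if_true] <;> split_ifs <;> norm_num
    · rw [if_neg h1]; split_ifs <;> norm_num
  refine (Finset.sum_le_sum fun I _ => h I).trans ?_
  rw [Finset.sum_add_distrib, two_mul]
  exact add_le_add (sum_ite_mem_powersetCard_le _) (sum_ite_mem_powersetCard_le _)

/-- The number of occurrences of `π` among the points `(x i, x (ρ i))`. -/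
noncomputable def pointCount (π : Equiv.Perm (Fin r)) (ρ : Equiv.Perm (Fin n))
    (x : Fin n → ℝ) : ℝ :=
  ∑ I, pointInd π ρ I x

lemma pointCount_eq_patternCount (π : Equiv.Perm (Fin r)) {ρ s : Equiv.Perm (Fin n)}
    {x : Fin n → ℝ} (hs : ∀ i j, x i < x j ↔ s i < s j) :
    pointCount π ρ x = patternCount π (s * ρ * s⁻¹) := by
  classical
  have hu : (Finset.univ : Finset (Fin n)).map s.toEmbedding = Finset.univ :=
    Finset.map_univ_equiv s
  rw [pointCount, patternCount]
  conv_rhs => rw [← hu, Finset.powersetCard_map, Finset.sum_map]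
  rw [← Finset.sum_coe_sort ((Finset.univ : Finset (Fin n)).powersetCard r)]
  push_cast
  refine Finset.sum_congr rfl fun I _ => ?_
  have hI := (Finset.mem_powersetCard.1 I.2).2
  simp only [pointInd, pointPattern_iff_inducesPattern hI hs, RelEmbedding.coe_toEmbedding,
    Finset.mapEmbedding_apply]
  congr

lemma exists_rank {x : Fin n → ℝ} (hx : Function.Injective x) :
    ∃ s : Equiv.Perm (Fin n), ∀ i j, x i < x j ↔ s i < s j := by
  have hm : StrictMono (x ∘ Tuple.sort x) :=
    (Tuple.monotone_sort x).strictMono_of_injective (hx.comp (Tuple.sort x).injective)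
  refine ⟨(Tuple.sort x)⁻¹, fun i j => ?_⟩
  rw [← hm.lt_iff_lt]
  simp

/-- The law of `n` independent uniform variables on `[0,1]`. -/
noncomputable abbrev unifLaw (n : ℕ) : Measure (Fin n → ℝ) :=
  Measure.pi fun _ => (volume : Measure ℝ).restrict (Icc 0 1)

instance : IsProbabilityMeasure ((volume : Measure ℝ).restrict (Icc 0 1)) :=
  ⟨by simp⟩

lemma ae_injective_unifLaw (n : ℕ) : ∀ᵐ x ∂(unifLaw n), Function.Injective x := by
  have h : ∀ᵐ x ∂(unifLaw n), ∀ i j : Fin n, i ≠ j → x i ≠ x j := by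
    simp only [ae_all_iff]
    intro i j hij
    rw [unifLaw, ← Measure.restrict_pi_pi]
    refine ae_restrict_of_ae ?_
    -- A coincidence `x i = x j` confines `x` to a proper subspace, a null set.
    let S : Submodule ℝ (Fin n → ℝ) :=
      LinearMap.ker ((LinearMap.proj i : (Fin n → ℝ) →ₗ[ℝ] ℝ) - LinearMap.proj j)
    have hS : S ≠ ⊤ := by
      intro h
      have : (Pi.single i 1 : Fin n → ℝ) ∈ S := h ▸ Submodule.mem_top
      simp [S, hij] at this
    have := Measure.addHaar_submodule (volume : Measure (Fin n → ℝ)) S hS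
    rw [← volume_pi, ae_iff]
    convert this using 2
    ext x; simp [S, sub_eq_zero]
  filter_upwards [h] with x hx i j hij
  by_contra hne
  exact hx i j hne hij

lemma integral_comp_perm_unifLaw (s : Equiv.Perm (Fin n)) (f : (Fin n → ℝ) → ℝ) :
    ∫ x, f (fun i => x (s i)) ∂(unifLaw n) = ∫ x, f x ∂(unifLaw n) := by
  have h := measurePreserving_piCongrLeft
    (fun _ : Fin n => (volume : Measure ℝ).restrict (Icc 0 1)) s⁻¹
  rw [← h.integral_comp (MeasurableEquiv.measurableEmbedding _) f]
  congr 1; funext x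
  congr 1; funext i
  have := Equiv.piCongrLeft_apply_apply (fun _ : Fin n => ℝ) s⁻¹ x (s i)
  simpa [MeasurableEquiv.coe_piCongrLeft] using this.symm

/-- The pattern count of a uniform permutation with given cycle type has the law of the number of
patterns among the points `(U i, U (ρ i))` for independent uniform `U i`. -/
theorem integral_pointCount_eq (π : Equiv.Perm (Fin r)) (t : n.Partition) {ρ : Equiv.Perm (Fin n)}
    (hρ : IsCyclicOfType t ρ) (B : ℝ → ℝ) (hB : BddMeas fun x => B (pointCount π ρ x)) :
    ∫ x, B (pointCount π ρ x) ∂(unifLaw n) =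
      ∫ κ, B (patternCount π κ) ∂(uniformOn {κ : Equiv.Perm (Fin n) | IsCyclicOfType t κ}) := by
  classical
  set F : Finset (Equiv.Perm (Fin n)) := Finset.univ.filter fun κ => IsCyclicOfType t κ with hF
  have hFS : {κ : Equiv.Perm (Fin n) | IsCyclicOfType t κ} = (F : Set _) := by ext; simp [hF]
  have hcard : (F.card : ℝ) ≠ 0 := by
    have : F.Nonempty := ⟨ρ, by simpa [hF] using hρ⟩
    exact_mod_cast this.card_pos.ne'
  have hcard' : (Fintype.card (Equiv.Perm (Fin n)) : ℝ) ≠ 0 := by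
    exact_mod_cast Fintype.card_ne_zero
  have h1 := card_mul_sum_conjClass t hρ fun κ => B (patternCount π κ)
  rw [hFS, integral_uniformOn_finset]
  -- If `u` ranks `x`, then `u * s` ranks the relabelled point, so the sum over all relabellings
  -- does not depend on `x`. As relabelling preserves the law, the distribution of the ranking is
  -- never needed.
  have h2 : ∀ᵐ x ∂(unifLaw n), ∑ s : Equiv.Perm (Fin n), B (pointCount π ρ fun i => x (s i)) =
      ∑ s : Equiv.Perm (Fin n), B (patternCount π (s * ρ * s⁻¹)) := by
    filter_upwards [ae_injective_unifLaw n] with x hx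
    obtain ⟨u, hu⟩ := exists_rank hx
    rw [← Equiv.sum_comp (Equiv.mulLeft u) fun s => B (patternCount π (s * ρ * s⁻¹))]
    refine Finset.sum_congr rfl fun s _ => ?_
    rw [pointCount_eq_patternCount (s := u * s) π fun i j => by simp [hu]]
    rfl
  have h3 := integral_congr_ae h2
  have hp : ∀ s : Equiv.Perm (Fin n), Measurable fun (x : Fin n → ℝ) i => x (s i) := fun s =>
    measurable_pi_lambda _ fun i => measurable_pi_apply _
  rw [integral_finsetSum _ fun s _ => (hB.comp (hp s)).integrable _,
    Finset.sum_congr rfl fun s _ => integral_comp_perm_unifLaw s fun x => B (pointCount π ρ x)]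
    at h3
  simp only [Finset.sum_const, Finset.card_univ, nsmul_eq_mul, integral_const, probReal_univ,
    one_smul] at h3
  field_simp
  rw [← h3] at h1
  apply mul_left_cancel₀ hcard'
  rw [h1]; ring

end Geometric

/-! ### Kolmogorov bound for a uniform permutation of given cycle type -/

section Main

variable {n r : ℕ}

lemma BddMeas.of_finite {E : Type*} [Finite E] [MeasurableSpace E] [DiscreteMeasurableSpace E]
    (f : E → ℝ) : BddMeas f := by
  obtain ⟨C, hC⟩ := (Set.finite_range fun x => |f x|).bddAbove
  exact ⟨Measurable.of_discrete, C, fun x => hC (mem_range_self x)⟩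

/-- The uniform law on permutations of cycle type `t`. -/
noncomputable abbrev cyclicLaw (t : n.Partition) : Measure (Equiv.Perm (Fin n)) :=
  uniformOn {κ : Equiv.Perm (Fin n) | IsCyclicOfType t κ}

lemma exists_isCyclicOfType (t : n.Partition) [IsProbabilityMeasure (cyclicLaw t)] :
    ∃ ρ, IsCyclicOfType t ρ := by
  by_contra! h
  have h0 : {κ : Equiv.Perm (Fin n) | IsCyclicOfType t κ} = ∅ := by
    ext κ; simpa using h κ
  have h1 : cyclicLaw t univ = 1 := measure_univ
  rw [cyclicLaw, h0, uniformOn_empty_meas] at h1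
  simp at h1

lemma bddMeas_pointCount (π : Equiv.Perm (Fin r)) (ρ : Equiv.Perm (Fin n)) :
    BddMeas (pointCount π ρ) :=
  BddMeas.sum _ fun I _ => ⟨measurable_pointInd π ρ I, 1, fun x => by
    rw [abs_of_nonneg ((isLocalFamily_pointInd π ρ).nonneg I x)]
    exact (isLocalFamily_pointInd π ρ).le_one I x⟩

/-- The constant is `6 · 2 · 2² · 7/8 = 42`, with `7/8` a rational upper bound for `1/√2`. -/
lemma error_bound_le (hr : 1 ≤ r) (n : ℕ) {V : ℝ} (hV : 0 < V) :
    6 * (2 * r) * (2 * ((n : ℝ) ^ (r - 1) / (r - 1).factorial)) ^ 2 * √(n / 2) / V ≤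
      42 * ((r : ℝ) / ((r - 1).factorial : ℝ) ^ 2) * ((n : ℝ) ^ (2 * (r : ℝ) - 3 / 2) / V) := by
  rcases n.eq_zero_or_pos with rfl | hn
  · simp; positivity
  have hn' : (0 : ℝ) < n := by exact_mod_cast hn
  have h1 : √((n : ℝ) / 2) ≤ 7 / 8 * √n := by
    rw [Real.sqrt_le_left (by positivity), mul_pow, Real.sq_sqrt hn'.le]
    linarith
  have h2 : (n : ℝ) ^ (2 * (r : ℝ) - 3 / 2) = ((n : ℝ) ^ (r - 1)) ^ 2 * √n := by
    rw [Real.sqrt_eq_rpow, ← pow_mul, ← Real.rpow_natCast, ← Real.rpow_add hn']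
    congr 1
    push_cast [hr]
    ring
  calc _ ≤ 6 * (2 * r) * (2 * ((n : ℝ) ^ (r - 1) / (r - 1).factorial)) ^ 2 * (7 / 8 * √n) / V := by
        gcongr
    _ = _ := by rw [h2]; ring

theorem abs_cyclicLaw_le_sub_gaussian_le (hr : 1 ≤ r) (π : Equiv.Perm (Fin r)) (t : n.Partition)
    [IsProbabilityMeasure (cyclicLaw t)] {m V : ℝ}
    (hm : m = ∫ κ, (patternCount π κ : ℝ) ∂(cyclicLaw t))
    (hV : V = ∫ κ, ((patternCount π κ : ℝ) - m) ^ 2 ∂(cyclicLaw t)) (hV0 : 0 < V) (z : ℝ) :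
    |(cyclicLaw t).real {κ | ((patternCount π κ : ℝ) - m) / √V ≤ z}
        - (gaussianReal 0 1).real (Iic z)| ≤
      42 * ((r : ℝ) / ((r - 1).factorial : ℝ) ^ 2) * ((n : ℝ) ^ (2 * (r : ℝ) - 3 / 2) / V) := by
  obtain ⟨ρ, hρ⟩ := exists_isCyclicOfType t
  have hb := bddMeas_pointCount π ρ
  have hbm := hb.sub (BddMeas.const m)
  -- Mean, variance and distribution function are transferred to the uniform points by three choices
  -- of test function.
  have hmean := integral_pointCount_eq π t hρ (fun x => x) hb
  have hvar := integral_pointCount_eq π t hρ (fun x => (x - m) ^ 2)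
    (by simpa only [sq] using hbm.mul hbm)
  have hcdf := integral_pointCount_eq π t hρ (fun x => if (x - m) / √V ≤ z then (1 : ℝ) else 0)
    (by simpa only [div_eq_mul_inv] using (hbm.mul (BddMeas.const (√V)⁻¹)).ite_le z)
  have e1 : (unifLaw n).real {x | (pointCount π ρ x - m) / √V ≤ z} =
      ∫ x, (if (pointCount π ρ x - m) / √V ≤ z then (1 : ℝ) else 0) ∂(unifLaw n) := by
    rw [← integral_indicator_one (measurableSet_le (hbm.1.div_const _) measurable_const)]
    rfl
  have e2 : (cyclicLaw t).real {κ | ((patternCount π κ : ℝ) - m) / √V ≤ z} =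
      ∫ κ, (if ((patternCount π κ : ℝ) - m) / √V ≤ z then (1 : ℝ) else 0) ∂(cyclicLaw t) := by
    rw [← integral_indicator_one (MeasurableSet.of_discrete)]
    rfl
  rw [e2, ← hcdf, ← e1]
  exact ((isLocalFamily_pointInd π ρ).abs_measure_le_sub_gaussian_le (measurable_pointInd π ρ) _
    (card_pointSupport_le ρ) (by positivity) (by positivity) (sum_mem_pointSupport_le ρ)
    (hmean.trans hm.symm) (hvar.trans hV.symm) hV0 z).trans (error_bound_le hr n hV0)

lemma abs_sub_le_kolmogorovDist (μ ν : Measure ℝ) [IsProbabilityMeasure μ]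
    [IsProbabilityMeasure ν] (x : ℝ) :
    |μ.real (Iic x) - ν.real (Iic x)| ≤ kolmogorovDist μ ν := by
  refine le_ciSup (f := fun x => |μ.real (Iic x) - ν.real (Iic x)|) ⟨1, ?_⟩ x
  rintro _ ⟨y, rfl⟩
  have h1 : 0 ≤ μ.real (Iic y) := measureReal_nonneg
  have h2 : 0 ≤ ν.real (Iic y) := measureReal_nonneg
  have h3 : μ.real (Iic y) ≤ 1 := measureReal_le_one
  have h4 : ν.real (Iic y) ≤ 1 := measureReal_le_one
  rw [abs_le]; constructor <;> linarith

lemma kolmogorovDist_nonneg (μ ν : Measure ℝ) : 0 ≤ kolmogorovDist μ ν :=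
  Real.iSup_nonneg fun _ => abs_nonneg _

theorem kolmogorovDist_cyclicLaw_le (hr : 1 ≤ r) (π : Equiv.Perm (Fin r)) (t : n.Partition)
    [IsProbabilityMeasure (cyclicLaw t)] {m V : ℝ}
    (hm : m = ∫ κ, (patternCount π κ : ℝ) ∂(cyclicLaw t))
    (hV : V = ∫ κ, ((patternCount π κ : ℝ) - m) ^ 2 ∂(cyclicLaw t)) (hV0 : 0 < V) :
    kolmogorovDist ((cyclicLaw t).map fun κ => ((patternCount π κ : ℝ) - m) / √V)
        (gaussianReal 0 1) ≤
      42 * ((r : ℝ) / ((r - 1).factorial : ℝ) ^ 2) * ((n : ℝ) ^ (2 * (r : ℝ) - 3 / 2) / V) := by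
  refine ciSup_le fun z => ?_
  rw [map_measureReal_apply Measurable.of_discrete measurableSet_Iic]
  exact abs_cyclicLaw_le_sub_gaussian_le hr π t hm hV hV0 z

/-- Pointwise convergence of distribution functions implies weak convergence. -/
lemma tendsto_probabilityMeasure_of_tendsto_Iic {ι : Type*} {l : Filter ι}
    [l.IsCountablyGenerated] {μ : ι → ProbabilityMeasure ℝ} {ν : ProbabilityMeasure ℝ}
    (h : ∀ y, Tendsto (fun i => (μ i : Measure ℝ).real (Iic y)) l
      (𝓝 ((ν : Measure ℝ).real (Iic y)))) : Tendsto μ l (𝓝 ν) := by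
  -- Half-open intervals form a π-system containing arbitrarily small neighbourhoods of each point,
  -- and their measures are differences of distribution functions.
  refine IsPiSystem.tendsto_probabilityMeasure_of_tendsto_of_mem
    (S := {s | ∃ a b : ℝ, a < b ∧ Ioc a b = s}) ?_ ?_ ?_ ?_
  · simpa using isPiSystem_Ioc (id : ℝ → ℝ) id
  · rintro _ ⟨a, b, -, rfl⟩; exact measurableSet_Ioc
  · intro u hu x hx
    obtain ⟨ε, hε, hb⟩ := Metric.isOpen_iff.1 hu x hx
    refine ⟨Ioc (x - ε / 2) (x + ε / 2), ⟨_, _, by linarith, rfl⟩,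
      Ioc_mem_nhds (by linarith) (by linarith), fun y hy => hb ?_⟩
    rw [Metric.mem_ball, Real.dist_eq, abs_lt]
    constructor <;> linarith [hy.1, hy.2]
  · rintro _ ⟨a, b, hab, rfl⟩
    have key : ∀ m : ProbabilityMeasure ℝ, ((m (Ioc a b) : NNReal) : ℝ) =
        (m : Measure ℝ).real (Iic b) - (m : Measure ℝ).real (Iic a) := fun m => by
      have hd : Ioc a b = Iic b \ Iic a := by ext x; simp [and_comm]
      rw [hd, ← measureReal_sdiff (Iic_subset_Iic.2 hab.le) measurableSet_Iic]
      rfl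
    rw [← NNReal.tendsto_coe]
    simp only [key]
    exact (h b).sub (h a)

lemma continuous_gaussianReal_Iic : Continuous fun z => (gaussianReal 0 1).real (Iic z) := by
  simp only [gaussianReal_real_Iic]
  exact (continuous_iff_continuousAt.2 fun w => (hasDerivAt_gaussTail w).continuousAt).div_const _

lemma gaussianReal_sq_real_Iic {σ : ℝ} (hσ : 0 < σ) (y : ℝ) :
    (gaussianReal 0 (σ ^ 2).toNNReal).real (Iic y) = (gaussianReal 0 1).real (Iic (y / σ)) := by
  have h := gaussianReal_map_const_mul (μ := 0) (v := 1) σ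
  have h2 : (σ ^ 2).toNNReal = NNReal.mk (σ ^ 2) (sq_nonneg σ) :=
    Real.toNNReal_of_nonneg _
  rw [mul_zero, mul_one] at h
  rw [h2, ← h, map_measureReal_apply (by fun_prop) measurableSet_Iic]
  congr 1
  ext x
  simp [le_div_iff₀' hσ]

end Main

end Patterns

/-! ### Asymptotics under the variance hypothesis -/

section Asymptotic

open Set
open scoped Topology

variable {r : ℕ} {V : ℕ → ℝ} {σ : ℝ}

lemma tendsto_variance_ratio
    (hV : (fun n : ℕ => V n - σ ^ 2 * (n : ℝ) ^ (2 * (r : ℝ) - 1))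
      =o[atTop] (fun n : ℕ => (n : ℝ) ^ (2 * (r : ℝ) - 1))) :
    Tendsto (fun n : ℕ => V n / (n : ℝ) ^ (2 * (r : ℝ) - 1)) atTop (𝓝 (σ ^ 2)) := by
  have h := hV.tendsto_div_nhds_zero.add_const (σ ^ 2)
  rw [zero_add] at h
  refine h.congr' ?_
  filter_upwards [eventually_gt_atTop 0] with n hn
  have : (n : ℝ) ^ (2 * (r : ℝ) - 1) ≠ 0 := (Real.rpow_pos_of_pos (by exact_mod_cast hn) _).ne'
  field_simp
  ring

lemma sq_rpow_sub_half (r n : ℕ) (hn : 0 < n) :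
    ((n : ℝ) ^ ((r : ℝ) - 1 / 2)) ^ 2 = (n : ℝ) ^ (2 * (r : ℝ) - 1) := by
  rw [sq, ← Real.rpow_add (by exact_mod_cast hn)]
  congr 1; ring

lemma tendsto_sqrt_variance_ratio (hσ : 0 ≤ σ)
    (hV : (fun n : ℕ => V n - σ ^ 2 * (n : ℝ) ^ (2 * (r : ℝ) - 1))
      =o[atTop] (fun n : ℕ => (n : ℝ) ^ (2 * (r : ℝ) - 1))) :
    Tendsto (fun n : ℕ => √(V n) / (n : ℝ) ^ ((r : ℝ) - 1 / 2)) atTop (𝓝 σ) := by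
  have h := (tendsto_variance_ratio hV).sqrt
  rw [Real.sqrt_sq hσ] at h
  refine h.congr' ?_
  filter_upwards [eventually_gt_atTop 0] with n hn
  have h0 : (0 : ℝ) ≤ (n : ℝ) ^ ((r : ℝ) - 1 / 2) := by positivity
  rw [← sq_rpow_sub_half r n hn, Real.sqrt_div' _ (sq_nonneg _), Real.sqrt_sq h0]

/-- Eventually the variance exceeds half its asymptotic value, which is the source of the factor `2
/ σ ^ 2`. -/
lemma eventually_variance_ge (hσ : 0 < σ)
    (hV : (fun n : ℕ => V n - σ ^ 2 * (n : ℝ) ^ (2 * (r : ℝ) - 1))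
      =o[atTop] (fun n : ℕ => (n : ℝ) ^ (2 * (r : ℝ) - 1))) :
    ∀ᶠ n in atTop, 0 < n ∧ 0 < V n ∧
      (n : ℝ) ^ (2 * (r : ℝ) - 3 / 2) / V n ≤ 2 / σ ^ 2 * (n : ℝ) ^ (-(1 / 2) : ℝ) := by
  have h2 : σ ^ 2 / 2 < σ ^ 2 := by linarith [pow_pos hσ 2]
  filter_upwards [eventually_gt_atTop 0, (tendsto_variance_ratio hV).eventually (lt_mem_nhds h2)]
    with n hn h
  have hn' : (0 : ℝ) < n := by exact_mod_cast hn
  have hN : 0 < (n : ℝ) ^ (2 * (r : ℝ) - 1) := Real.rpow_pos_of_pos hn' _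
  rw [lt_div_iff₀ hN] at h
  have hV0 : 0 < V n := lt_trans (by positivity) h
  refine ⟨hn, hV0, ?_⟩
  have e : (n : ℝ) ^ (2 * (r : ℝ) - 3 / 2) =
      (n : ℝ) ^ (2 * (r : ℝ) - 1) * (n : ℝ) ^ (-(1 / 2) : ℝ) := by
    rw [← Real.rpow_add hn']; congr 1; ring
  rw [e, div_le_iff₀ hV0]
  have hh : 0 < (n : ℝ) ^ (-(1 / 2) : ℝ) := Real.rpow_pos_of_pos hn' _
  calc _ = 2 / σ ^ 2 * (n : ℝ) ^ (-(1 / 2) : ℝ) * (σ ^ 2 / 2 * (n : ℝ) ^ (2 * (r : ℝ) - 1)) := by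
        field_simp
    _ ≤ _ := by gcongr

variable (π : Equiv.Perm (Fin r)) (t : ∀ n : ℕ, n.Partition)
  [hprob : ∀ n, IsProbabilityMeasure (cyclicLaw (t n))] {m : ℕ → ℝ}

include hprob in
theorem isBigO_kolmogorovDist_cyclicLaw (hr : 1 ≤ r)
    (hm : ∀ n, m n = ∫ κ, (patternCount π κ : ℝ) ∂(cyclicLaw (t n)))
    (hV : ∀ n, V n = ∫ κ, ((patternCount π κ : ℝ) - m n) ^ 2 ∂(cyclicLaw (t n))) (hσ : 0 < σ)
    (ho : (fun n : ℕ => V n - σ ^ 2 * (n : ℝ) ^ (2 * (r : ℝ) - 1))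
      =o[atTop] (fun n : ℕ => (n : ℝ) ^ (2 * (r : ℝ) - 1))) :
    (fun n : ℕ => kolmogorovDist
      ((cyclicLaw (t n)).map fun κ => ((patternCount π κ : ℝ) - m n) / √(V n)) (gaussianReal 0 1))
      =O[atTop] (fun n : ℕ => (n : ℝ) ^ (-(1 / 2) : ℝ)) := by
  refine IsBigO.of_bound (42 * ((r : ℝ) / ((r - 1).factorial : ℝ) ^ 2) * (2 / σ ^ 2)) ?_
  filter_upwards [eventually_variance_ge hσ ho] with n hn
  rw [Real.norm_of_nonneg (kolmogorovDist_nonneg _ _), Real.norm_of_nonneg (by positivity),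
    mul_assoc _ (2 / σ ^ 2)]
  refine (kolmogorovDist_cyclicLaw_le hr π (t n) (hm n) (hV n) hn.2.1).trans ?_
  gcongr
  exact hn.2.2

include hprob in
-- Normalising by `n^(r-1/2)` instead of `√V` moves the threshold from `y` to `y / s n` with `s n →
-- σ`. The Kolmogorov bound is uniform in the threshold, and continuity of the Gaussian distribution
-- function absorbs the shift.
theorem tendsto_measure_Iic_cyclicLaw (hr : 1 ≤ r)
    (hm : ∀ n, m n = ∫ κ, (patternCount π κ : ℝ) ∂(cyclicLaw (t n)))
    (hV : ∀ n, V n = ∫ κ, ((patternCount π κ : ℝ) - m n) ^ 2 ∂(cyclicLaw (t n))) (hσ : 0 < σ)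
    (ho : (fun n : ℕ => V n - σ ^ 2 * (n : ℝ) ^ (2 * (r : ℝ) - 1))
      =o[atTop] (fun n : ℕ => (n : ℝ) ^ (2 * (r : ℝ) - 1))) (y : ℝ) :
    Tendsto (fun n : ℕ => ((cyclicLaw (t n)).map fun κ => ((patternCount π κ : ℝ) - m n) /
      (n : ℝ) ^ ((r : ℝ) - 1 / 2)).real (Iic y)) atTop
      (𝓝 ((gaussianReal 0 (σ ^ 2).toNNReal).real (Iic y))) := by
  rw [gaussianReal_sq_real_Iic hσ]
  set s : ℕ → ℝ := fun n => √(V n) / (n : ℝ) ^ ((r : ℝ) - 1 / 2) with hs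
  have hlim : Tendsto (fun n => (gaussianReal 0 1).real (Iic (y / s n))) atTop
      (𝓝 ((gaussianReal 0 1).real (Iic (y / σ)))) :=
    (continuous_gaussianReal_Iic.tendsto _).comp
      (tendsto_const_nhds.div (tendsto_sqrt_variance_ratio hσ.le ho) hσ.ne')
  have hz : Tendsto (fun n : ℕ => (n : ℝ) ^ (-(1 / 2) : ℝ)) atTop (𝓝 0) :=
    (tendsto_rpow_neg_atTop (by norm_num)).comp tendsto_natCast_atTop_atTop
  have hd := (isBigO_kolmogorovDist_cyclicLaw π t hr hm hV hσ ho).trans_tendsto hz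
  have hdiff : Tendsto (fun n : ℕ => ((cyclicLaw (t n)).map fun κ =>
      ((patternCount π κ : ℝ) - m n) / (n : ℝ) ^ ((r : ℝ) - 1 / 2)).real (Iic y)
      - (gaussianReal 0 1).real (Iic (y / s n))) atTop (𝓝 0) := by
    refine squeeze_zero_norm' ?_ hd
    filter_upwards [eventually_variance_ge hσ ho] with n hn
    have hn' : (0 : ℝ) < n := by exact_mod_cast hn.1
    have hN : 0 < (n : ℝ) ^ ((r : ℝ) - 1 / 2) := Real.rpow_pos_of_pos hn' _
    have hsV : 0 < √(V n) := Real.sqrt_pos.2 hn.2.1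
    have : IsProbabilityMeasure ((cyclicLaw (t n)).map fun κ =>
        ((patternCount π κ : ℝ) - m n) / √(V n)) :=
      Measure.isProbabilityMeasure_map Measurable.of_discrete.aemeasurable
    refine le_trans (le_of_eq ?_) (abs_sub_le_kolmogorovDist _ _ (y / s n))
    rw [Real.norm_eq_abs, map_measureReal_apply Measurable.of_discrete measurableSet_Iic,
      map_measureReal_apply Measurable.of_discrete measurableSet_Iic]
    congr 3
    ext κ
    simp only [mem_preimage, mem_Iic, hs]
    rw [div_le_iff₀ hN, div_le_iff₀ hsV, div_div_eq_mul_div, div_mul_cancel₀ _ hsV.ne']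
  simpa using hdiff.add hlim

include hprob in
-- The degenerate case: the integral differs from `f 0` by at most `L` times the first absolute
-- moment, itself at most the root of the second, which tends to `0`.
theorem tendsto_integral_lipschitz_cyclicLaw
    (hV : ∀ n, V n = ∫ κ, ((patternCount π κ : ℝ) - m n) ^ 2 ∂(cyclicLaw (t n)))
    (ho : (fun n : ℕ => V n - (0 : ℝ) ^ 2 * (n : ℝ) ^ (2 * (r : ℝ) - 1))
      =o[atTop] (fun n : ℕ => (n : ℝ) ^ (2 * (r : ℝ) - 1))) {f : ℝ → ℝ} {L : NNReal}
    (hf : LipschitzWith L f) :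
    Tendsto (fun n : ℕ => ∫ κ, f (((patternCount π κ : ℝ) - m n) /
      (n : ℝ) ^ ((r : ℝ) - 1 / 2)) ∂(cyclicLaw (t n))) atTop (𝓝 (f 0)) := by
  have hs := (tendsto_sqrt_variance_ratio le_rfl ho).const_mul (L : ℝ)
  rw [mul_zero] at hs
  rw [tendsto_iff_norm_sub_tendsto_zero]
  refine squeeze_zero' (Eventually.of_forall fun _ => norm_nonneg _) ?_ hs
  filter_upwards with n
  set Y : Equiv.Perm (Fin n) → ℝ := fun κ => ((patternCount π κ : ℝ) - m n) /
    (n : ℝ) ^ ((r : ℝ) - 1 / 2) with hY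
  have hN : 0 ≤ (n : ℝ) ^ ((r : ℝ) - 1 / 2) := by positivity
  have h1 := sq_integral_abs_le (cyclicLaw (t n)) (BddMeas.of_finite Y)
  have h2 : ∫ κ, Y κ * Y κ ∂(cyclicLaw (t n)) = V n / ((n : ℝ) ^ ((r : ℝ) - 1 / 2)) ^ 2 := by
    rw [hV, ← integral_div]
    congr 1; funext κ; rw [hY, ← sq, div_pow]
  rw [h2] at h1
  have h3 : ∫ κ, |Y κ| ∂(cyclicLaw (t n)) ≤ √(V n) / (n : ℝ) ^ ((r : ℝ) - 1 / 2) := by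
    have := Real.abs_le_sqrt h1
    rw [Real.sqrt_div' _ (sq_nonneg _), Real.sqrt_sq hN] at this
    exact (le_abs_self _).trans this
  have h4 : (∫ κ, f (Y κ) ∂(cyclicLaw (t n))) - f 0 =
      ∫ κ, (f (Y κ) - f 0) ∂(cyclicLaw (t n)) := by
    rw [integral_sub ((BddMeas.of_finite fun κ => f (Y κ)).integrable _) (integrable_const _)]
    simp
  rw [h4]
  calc _ ≤ ∫ κ, ‖f (Y κ) - f 0‖ ∂(cyclicLaw (t n)) := norm_integral_le_integral_norm _
    _ ≤ ∫ κ, L * |Y κ| ∂(cyclicLaw (t n)) := by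
      refine integral_mono ((BddMeas.of_finite _).integrable _)
        ((BddMeas.of_finite _).integrable _) fun κ => ?_
      have := hf.dist_le_mul (Y κ) 0
      rwa [Real.dist_eq, Real.dist_eq, sub_zero] at this
    _ ≤ _ := by
      rw [integral_const_mul]
      exact mul_le_mul_of_nonneg_left h3 L.2

end Asymptotic

theorem mainTheorem7
    (r : ℕ) (hr : 1 ≤ r) (π : Equiv.Perm (Fin r))
    (t : ∀ n : ℕ, n.Partition)
    {Ω : ℕ → Type*} [∀ n, MeasurableSpace (Ω n)]
    (P : ∀ n, Measure (Ω n)) [∀ n, IsProbabilityMeasure (P n)]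
    (τ : ∀ n, Ω n → Equiv.Perm (Fin n))
    (hτ : ∀ n, IsUniformCyclic (t n) (τ n) (P n))
    (X : ∀ n, Ω n → ℝ) (hX : ∀ n ω, X n ω = (patternCount π (τ n ω) : ℝ))
    (m V : ℕ → ℝ) (hm : ∀ n, m n = ∫ ω, X n ω ∂(P n)) (hV : ∀ n, V n = variance (X n) (P n)) :
    (∀ n, 0 < V n →
      kolmogorovDist ((P n).map fun ω => (X n ω - m n) / √(V n)) (gaussianReal 0 1) ≤
        42 * ((r : ℝ) / ((r - 1).factorial : ℝ) ^ 2)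
            * ((n : ℝ) ^ (2 * (r : ℝ) - 3 / 2) / V n)
          + 72 * ((r : ℝ) / ((r - 1).factorial : ℝ) ^ 3)
            * ((n : ℝ) ^ (3 * (r : ℝ) - 2) / V n ^ (3 / 2 : ℝ))) ∧
    (∀ σ : ℝ, 0 ≤ σ →
      (fun n : ℕ => V n - σ ^ 2 * (n : ℝ) ^ (2 * (r : ℝ) - 1))
        =o[atTop] (fun n : ℕ => (n : ℝ) ^ (2 * (r : ℝ) - 1)) →
      TendstoInDistribution
          (fun n ω => (X n ω - m n) / (n : ℝ) ^ ((r : ℝ) - 1 / 2))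
          atTop (fun y : ℝ => y) P (gaussianReal 0 (σ ^ 2).toNNReal) ∧
      (0 < σ →
        (fun n : ℕ =>
          kolmogorovDist ((P n).map fun ω => (X n ω - m n) / √(V n)) (gaussianReal 0 1))
          =O[atTop] (fun n : ℕ => (n : ℝ) ^ (-(1 / 2) : ℝ)))) := by
  have hτm : ∀ n, AEMeasurable (τ n) (P n) := fun n => (hτ n).aemeasurable
  have hlaw : ∀ n, (P n).map (τ n) = cyclicLaw (t n) := fun n => (hτ n).map_eq
  have : ∀ n, IsProbabilityMeasure (cyclicLaw (t n)) := fun n =>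
    hlaw n ▸ Measure.isProbabilityMeasure_map (hτm n)
  have hmap : ∀ n (g : Equiv.Perm (Fin n) → ℝ),
      (P n).map (fun ω => g (τ n ω)) = (cyclicLaw (t n)).map g := fun n g => by
    rw [← hlaw n, AEMeasurable.map_map_of_aemeasurable Measurable.of_discrete.aemeasurable (hτm n)]
    rfl
  have hint : ∀ n (g : Equiv.Perm (Fin n) → ℝ),
      ∫ ω, g (τ n ω) ∂(P n) = ∫ κ, g κ ∂(cyclicLaw (t n)) := fun n g => by
    rw [← hlaw n, integral_map (hτm n) (Measurable.of_discrete (f := g)).aestronglyMeasurable]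
  have haem : ∀ n (g : Equiv.Perm (Fin n) → ℝ), AEMeasurable (fun ω => g (τ n ω)) (P n) :=
    fun n g => (Measurable.of_discrete (f := g)).comp_aemeasurable (hτm n)
  have hXe : ∀ n, X n = fun ω => (patternCount π (τ n ω) : ℝ) := fun n => funext (hX n)
  have hm' : ∀ n, m n = ∫ κ, (patternCount π κ : ℝ) ∂(cyclicLaw (t n)) := fun n => by
    rw [hm, hXe]; exact hint n fun κ => (patternCount π κ : ℝ)
  have hV' : ∀ n, V n = ∫ κ, ((patternCount π κ : ℝ) - m n) ^ 2 ∂(cyclicLaw (t n)) := fun n => by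
    rw [hV, variance_eq_integral (by rw [hXe]; exact haem n fun κ => (patternCount π κ : ℝ)),
      ← hm, hXe]
    exact hint n fun κ => ((patternCount π κ : ℝ) - m n) ^ 2
  have hK : ∀ n, (P n).map (fun ω => (X n ω - m n) / √(V n)) =
      (cyclicLaw (t n)).map fun κ => ((patternCount π κ : ℝ) - m n) / √(V n) := fun n => by
    rw [hXe]; exact hmap n fun κ => ((patternCount π κ : ℝ) - m n) / √(V n)
  have hY : ∀ n, (P n).map (fun ω => (X n ω - m n) / (n : ℝ) ^ ((r : ℝ) - 1 / 2)) =
      (cyclicLaw (t n)).map fun κ => ((patternCount π κ : ℝ) - m n) /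
        (n : ℝ) ^ ((r : ℝ) - 1 / 2) := fun n => by
    rw [hXe]
    exact hmap n fun κ => ((patternCount π κ : ℝ) - m n) / (n : ℝ) ^ ((r : ℝ) - 1 / 2)
  refine ⟨fun n hn => ?_, fun σ hσ ho => ⟨⟨fun n => ?_, aemeasurable_id', ?_⟩, fun hσ0 => ?_⟩⟩
  · rw [hK]
    refine (kolmogorovDist_cyclicLaw_le hr π (t n) (hm' n) (hV' n) hn).trans ?_
    -- The first error term suffices; the second is only added as a nonnegative quantity.
    exact le_add_of_nonneg_right (by positivity)
  · rw [hXe]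
    exact haem n fun κ => ((patternCount π κ : ℝ) - m n) / (n : ℝ) ^ ((r : ℝ) - 1 / 2)
  · rcases hσ.eq_or_lt with rfl | hσ0
    -- The limit is a Dirac mass, whose distribution function jumps, so Lipschitz test functions
    -- replace distribution functions.
    · refine tendsto_iff_forall_lipschitz_integral_tendsto.2 ?_
      rintro f - ⟨L, hL⟩
      have h := tendsto_integral_lipschitz_cyclicLaw π t hV' ho hL
      have h0 : ∀ n, ∫ x, f x ∂((P n).map fun ω => (X n ω - m n) / (n : ℝ) ^ ((r : ℝ) - 1 / 2)) =
          ∫ κ, f (((patternCount π κ : ℝ) - m n) / (n : ℝ) ^ ((r : ℝ) - 1 / 2))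
            ∂(cyclicLaw (t n)) := fun n => by
        rw [hY, integral_map Measurable.of_discrete.aemeasurable
          hL.continuous.aestronglyMeasurable]
      have h1 : ∫ x, f x ∂((gaussianReal 0 ((0 : ℝ) ^ 2).toNNReal).map fun y => y) = f 0 := by
        simp
      rw [← h1] at h
      exact h.congr fun n => (h0 n).symm
    · refine tendsto_probabilityMeasure_of_tendsto_Iic fun y => ?_
      change Tendsto (fun n => ((P n).map fun ω =>
          (X n ω - m n) / (n : ℝ) ^ ((r : ℝ) - 1 / 2)).real (Set.Iic y)) atTop
        (nhds (((gaussianReal 0 (σ ^ 2).toNNReal).map fun y => y).real (Set.Iic y)))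
      simp only [hY, Measure.map_id']
      exact tendsto_measure_Iic_cyclicLaw π t hr hm' hV' hσ0 ho y
  · simp only [hK]
    exact isBigO_kolmogorovDist_cyclicLaw π t hr hm' hV' hσ0 ho
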